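/- Let $M$ be a closed (compact, boundaryless) smooth manifold with a continuous Riemannian metric and a compatible distance $d$, and let $f:M\to M$ be a $C^1$-diffeomorphism. **Definitions.** Write $x\dashv y$ if for every $\varepsilon>0$ there are $n\ge 1$ and $z_0=x,z_1,\dots,z_n=y$ with $d(f(z_i),z_{i+1})<\varepsilon$ for $0\le i<n$. The *chain-recurrence classes* of $f$ are the equivalence classes of the relation ($x\dashv y$ and $y\dashv x$) on $\{x: x\dashv x\}$. A set $U$ is *filtrating* if $U=V_1\setminus\overline{V_2}$ with $V_1,V_2$ open and $f(\overline{V_i})\subset V_i$; its *maximal invariant set* is $\Lambda=\bigcap_{n\in\mathbb Z}f^n(U)$. The set $\Lambda$ is *partially hyperbolic* with splitting $T_\Lambda M=E^{cs}\oplus E^u$ if it is compact, $E^{cs},E^u$ are continuous $Df$-invariant subbundles of constant rank, $E^u$ *dominates* $E^{cs}$ (there is $N>0$ with $\|Df^N_xv\|<\frac12\|Df^N_xw\|$ for all $x\in\Lambda$ and unit vectors $v\in E^{cs}(x)$, $w\in E^u(x)$), and there is $N>0$ with $\|Df^N_xv\|>2$ for all $x\in\Lambda$ and unit vectors $v\in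 E^u(x)$. A *$d$-dimensional lamination* of a set $K\subset M$ is a decomposition of $K$ into disjoint injectively immersed connected $C^1$ manifolds (the *leaves*, with their own manifold topology) such that every point of $K$ has a relatively open neighbourhood in $K$ that is homeomorphic to a product $T\times\mathbb R^d$, each $\{s\}\times\mathbb R^d$ being sent by a $C^1$ immersion onto an open subset of a leaf. The *strong unstable lamination* $\mathcal F^u$ is the $f$-invariant lamination of a set containing $\Lambda$ whose leaves have continuously varying tangent spaces, equal to $E^u$ at $\Lambda$. The bundle $E^{cs}$ is *coherent* if there is an $f$-invariant lamination $\mathcal F^{cs}$ of a set containing $\Lambda$ whose leaves are tangent to $E^{cs}$ at the points of $\Lambda$. For $x\in\Lambda$ and $W$ open, $\mathcal F^{\sigma}_W(x)$ is the connected component, in the leaf topology, of $\mathcal F^{\sigma}(x)\cap W$ that contains $x$ ($\sigma=cs,u$). For $y\in\Lambda\cap\mathcal F^u(x)$ close to $x\in \Lambda$ in the leaf, the *unstable holonomy* from a neighbourhood of $x$ in $\mathcal F^{cs}_U(x)\cap\Lambda$ to $\mathcal F^{cs}_U(y)\cap\Lambda$ sends $z$ to the point in which the local leaf of $\mathcal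 F^u$ through $z$ meets the local leaf of $\mathcal F^{cs}$ through $y$. **Statement.** Let $U$ be a filtrating set whose maximal invariant set $\Lambda$ is partially hyperbolic with splitting $T_\Lambda M=E^{cs}\oplus E^u$, with $E^{cs}$ coherent, tangent to the lamination $\mathcal F^{cs}$. Let $\Gamma$ be a compact metric space, $g:\Gamma\to\Gamma$ a homeomorphism and $h:\Lambda\to\Gamma$ a continuous surjective map such that: 1. $g\circ h=h\circ f$ on $\Lambda$; 2. $h$ is injective on unstable manifolds, that is, on $\mathcal F^u(x)\cap\Lambda$ for every $x\in\Lambda$; 3. there is a chain-recurrence class $Q$ of $f$ such that for every $x\in\Lambda$ the fibre $h^{-1}(\{h(x)\})$ is contained in $\mathcal F^{cs}_U(x)$, and its topological frontier relative to $\mathcal F^{cs}_U(x)$ (in the leaf topology) is contained in $Q$; 4. the fibres of $h$ are invariant under unstable holonomy: where it is defined, the holonomy from $x$ to $y$ sends points of $h^{-1}(\{h(x)\})$ to points of $h^{-1}(\{h(y)\})$; 5. $g$ is expansive: there is $\alpha>0$ such that for all $x\ne y$ in $\Gamma$ there is $n\in\mathbb Z$ with $d(g^n(x),g^n(y))\ge\alpha$.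 Then for every chain-recurrence class $R\ne Q$ of $f$ contained in $U$ there is a periodic orbit $\mathcal O$ of $g$ with $R\subset h^{-1}(\mathcal O)$. -/

import Mathlib

open Set Filter Topology Manifold Bundle
open scoped ContDiff

universe u

/-! ### Topological dynamics -/

section Dynamics

/-- `x ⊣ y`: for every `ε > 0` there is an `ε`-pseudo-orbit `z 0 = x, …, z n = y` with `n ≥ 1`. -/
def ChainLeads {X : Type*} [PseudoMetricSpace X] (f : X → X) (x y : X) : Prop :=
  ∀ ε : ℝ, 0 < ε → ∃ (n : ℕ) (z : ℕ → X), 1 ≤ n ∧ z 0 = x ∧ z n = y ∧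
    ∀ i, i < n → dist (f (z i)) (z (i + 1)) < ε

/-- The chain-recurrent set of `f`. -/
def chainRecurrentSet {X : Type*} [PseudoMetricSpace X] (f : X → X) : Set X :=
  {x | ChainLeads f x x}

/-- `C` is a chain-recurrence class of `f`: an equivalence class of the relation
`x ⊣ y ∧ y ⊣ x` on the chain-recurrent set. -/
def IsChainRecurrenceClass {X : Type*} [PseudoMetricSpace X] (f : X → X) (C : Set X) : Prop :=
  ∃ x ∈ chainRecurrentSet f, C = {y ∈ chainRecurrentSet f | ChainLeads f x y ∧ ChainLeads f y x}

/-- `U` is a filtrating set of `f`. -/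
def IsFiltrating {X : Type*} [TopologicalSpace X] (f : X → X) (U : Set X) : Prop :=
  ∃ V₁ V₂ : Set X, IsOpen V₁ ∧ IsOpen V₂ ∧ U = V₁ \ closure V₂ ∧
    f '' closure V₁ ⊆ V₁ ∧ f '' closure V₂ ⊆ V₂

/-- The maximal invariant set of `f` in `U`: the points whose whole orbit stays in `U`. -/
def maximalInvariantSet {X : Type*} [TopologicalSpace X] (f : X ≃ₜ X) (U : Set X) : Set X :=
  {x | ∀ n : ℤ, (f ^ n) x ∈ U}

theorem map_mem_maximalInvariantSet {X : Type*} [TopologicalSpace X] (f : X ≃ₜ X) (U : Set X)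
    {x : X} (hx : x ∈ maximalInvariantSet f U) : f x ∈ maximalInvariantSet f U := by
  intro n
  have h := hx (n + 1)
  rw [zpow_add_one] at h
  exact h

/-- Expansive homeomorphisms. -/
def IsExpansive {X : Type*} [PseudoMetricSpace X] (g : X ≃ₜ X) : Prop :=
  ∃ α : ℝ, 0 < α ∧ ∀ x y : X, x ≠ y → ∃ n : ℤ, α ≤ dist ((g ^ n) x) ((g ^ n) y)

/-- The fibre `h⁻¹({y})` of a map `h` defined on a subset `Λ` of `X`, as a subset of `X`. -/
def fibre {X Γ : Type*} {Λ : Set X} (h : Λ → Γ) (y : Γ) : Set X :=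
  Subtype.val '' (h ⁻¹' {y})

/-- The topological frontier of `A` relative to the subspace `P`, for the topology `t`. -/
def relFrontier {X : Type*} (t : TopologicalSpace X) (P A : Set X) : Set X :=
  P ∩ @closure X t (P ∩ A) ∩ @closure X t (P \ A)

end Dynamics

/-! ### Partially hyperbolic sets -/

section PartialHyperbolicity

variable {m : ℕ} {M : Type u} [TopologicalSpace M] [ChartedSpace (EuclideanSpace ℝ (Fin m)) M]

/-- `E` is, over `A`, a (continuous) subbundle of rank `d` of the tangent bundle: near every point
of `A` it is spanned by `d` continuous linearly independent sections. -/
def IsSubbundleOn [IsManifold (𝓡 m) 1 M] (A : Set M) (d : ℕ)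
    (E : ∀ x : M, Submodule ℝ (TangentSpace (𝓡 m) x)) : Prop :=
  ∀ x₀ ∈ A, ∃ W ∈ 𝓝 x₀, ∃ s : Fin d → ∀ x : M, TangentSpace (𝓡 m) x,
    (∀ i, ContinuousOn (fun x => (⟨x, s i x⟩ : TangentBundle (𝓡 m) M)) (A ∩ W)) ∧
    ∀ x ∈ A ∩ W, LinearIndependent ℝ (fun i => s i x) ∧
      Submodule.span ℝ (range fun i => s i x) = E x

variable [RiemannianBundle (fun x : M => TangentSpace (𝓡 m) x)]

/-- `F` dominates `E` over `Λ`. -/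
def Dominates (f : M → M) (Λ : Set M) (F E : ∀ x : M, Submodule ℝ (TangentSpace (𝓡 m) x)) :
    Prop :=
  ∃ N : ℕ, 0 < N ∧ ∀ x ∈ Λ, ∀ v ∈ E x, ∀ w ∈ F x, ‖v‖ = 1 → ‖w‖ = 1 →
    ‖mfderiv (𝓡 m) (𝓡 m) (f^[N]) x v‖ < 1 / 2 * ‖mfderiv (𝓡 m) (𝓡 m) (f^[N]) x w‖

/-- The compact set `Λ` is partially hyperbolic for `f`, with `Df`-invariant splitting
`T_Λ M = Ecs ⊕ Eu` into subbundles of ranks `dcs` and `du`. -/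
structure IsPartiallyHyperbolic [IsManifold (𝓡 m) 1 M] (f : M → M) (Λ : Set M) (dcs du : ℕ)
    (Ecs Eu : ∀ x : M, Submodule ℝ (TangentSpace (𝓡 m) x)) : Prop where
  isCompact : IsCompact Λ
  subbundle_cs : IsSubbundleOn Λ dcs Ecs
  subbundle_u : IsSubbundleOn Λ du Eu
  splitting : ∀ x ∈ Λ, IsCompl (Ecs x) (Eu x)
  invariant_cs : ∀ x ∈ Λ, ∀ v ∈ Ecs x, mfderiv (𝓡 m) (𝓡 m) f x v ∈ Ecs (f x)
  invariant_u : ∀ x ∈ Λ, ∀ v ∈ Eu x, mfderiv (𝓡 m) (𝓡 m) f x v ∈ Eu (f x)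
  dominates : Dominates f Λ Eu Ecs
  expands : ∃ N : ℕ, 0 < N ∧ ∀ x ∈ Λ, ∀ v ∈ Eu x, ‖v‖ = 1 →
    2 < ‖mfderiv (𝓡 m) (𝓡 m) (f^[N]) x v‖

end PartialHyperbolicity

/-! ### Laminations -/

section Laminations

/-- A flow box of a `d`-dimensional lamination of `K`: a homeomorphism from a product `T × ℝᵈ` onto
a relatively open subset of `K`, whose restriction to each `{s} × ℝᵈ` (a plaque) is a `C¹`
immersion. -/
structure FlowBox (m : ℕ) (M : Type u) [TopologicalSpace M]
    [ChartedSpace (EuclideanSpace ℝ (Fin m)) M] (d : ℕ) (K : Set M) where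
  T : Type u
  [topT : TopologicalSpace T]
  toFun : T → EuclideanSpace ℝ (Fin d) → M
  isEmbedding : IsEmbedding (fun p : T × EuclideanSpace ℝ (Fin d) => toFun p.1 p.2)
  range_eq : ∃ W : Set M, IsOpen W ∧
    range (fun p : T × EuclideanSpace ℝ (Fin d) => toFun p.1 p.2) = K ∩ W
  contMDiff : ∀ s, ContMDiff (𝓡 d) (𝓡 m) 1 (toFun s)
  injective_mfderiv : ∀ s v, Function.Injective (mfderiv (𝓡 d) (𝓡 m) (toFun s) v)

attribute [instance] FlowBox.topT

/-- A `d`-dimensional lamination of a subset `support` of `M`: the support is covered by flow boxes,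
any two plaques of which meet in an open subset of each of them. -/
structure Lamination (m : ℕ) (M : Type u) [TopologicalSpace M]
    [ChartedSpace (EuclideanSpace ℝ (Fin m)) M] (d : ℕ) where
  support : Set M
  boxes : Set (FlowBox m M d support)
  cover : ∀ x ∈ support, ∃ φ ∈ boxes, ∃ s v, φ.toFun s v = x
  compatible : ∀ φ ∈ boxes, ∀ ψ ∈ boxes, ∀ s t,
    IsOpen {v | φ.toFun s v ∈ range (ψ.toFun t)}

namespace Lamination

variable {m : ℕ} {M : Type u} [TopologicalSpace M] [ChartedSpace (EuclideanSpace ℝ (Fin m)) M]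
  {d : ℕ}

/-- The leaf topology: a set is open when its trace on every plaque is open in the plaque. -/
@[reducible] def leafTopology (L : Lamination m M d) : TopologicalSpace M where
  IsOpen A := ∀ φ ∈ L.boxes, ∀ s, IsOpen (φ.toFun s ⁻¹' A)
  isOpen_univ := fun _ _ _ => isOpen_univ
  isOpen_inter := fun _ _ hA hB φ hφ s => (hA φ hφ s).inter (hB φ hφ s)
  isOpen_sUnion := fun S hS φ hφ s => by
    rw [preimage_sUnion]
    exact isOpen_biUnion fun A hA => hS A hA φ hφ s

/-- The leaf through `x`: its connected component in the leaf topology. -/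
def leaf (L : Lamination m M d) (x : M) : Set M :=
  @connectedComponent M L.leafTopology x

/-- The connected component, in the leaf topology, of `leaf x ∩ W` that contains `x`. -/
def localLeaf (L : Lamination m M d) (W : Set M) (x : M) : Set M :=
  @connectedComponentIn M L.leafTopology (L.leaf x ∩ W) x

/-- The lamination is invariant under `f`: `f` maps its support onto itself and leaves onto
leaves. -/
def IsInvariant (L : Lamination m M d) (f : M → M) : Prop :=
  f '' L.support = L.support ∧ ∀ x ∈ L.support, f '' L.leaf x = L.leaf (f x)

/-- The tangent space of the leaf at each point of `A ∩ support` is given by `E`. -/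
def IsTangentOn (L : Lamination m M d) (A : Set M)
    (E : ∀ x : M, Submodule ℝ (TangentSpace (𝓡 m) x)) : Prop :=
  ∀ φ ∈ L.boxes, ∀ s v, φ.toFun s v ∈ A →
    LinearMap.range (mfderiv (𝓡 d) (𝓡 m) (φ.toFun s) v).toLinearMap = E (φ.toFun s v)

end Lamination

variable {m : ℕ} {M : Type u}

/-- `L` is a lamination witnessing that the subbundle `Ecs` over `Λ` is coherent: it is defined on a
set containing `Λ`, is `f`-invariant, and is tangent to `Ecs` at `Λ`. -/
def IsCenterStableLamination [TopologicalSpace M] [ChartedSpace (EuclideanSpace ℝ (Fin m)) M]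
    {d : ℕ} (f : M → M) (Λ : Set M) (Ecs : ∀ x : M, Submodule ℝ (TangentSpace (𝓡 m) x))
    (L : Lamination m M d) : Prop :=
  Λ ⊆ L.support ∧ L.IsInvariant f ∧ L.IsTangentOn Λ Ecs

/-- `L` is the strong unstable lamination of `Λ`: it is `f`-invariant, and its leaves are tangent to
a continuous plane field on its support which is `Eu` at `Λ`. For a partially hyperbolic set the
leaves through points of `Λ` (the strong unstable manifolds) do not depend on `L`. -/
def IsStrongUnstableLamination [TopologicalSpace M] [ChartedSpace (EuclideanSpace ℝ (Fin m)) M]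
    [IsManifold (𝓡 m) 1 M] {d : ℕ} (f : M → M) (Λ : Set M)
    (Eu : ∀ x : M, Submodule ℝ (TangentSpace (𝓡 m) x)) (L : Lamination m M d) : Prop :=
  Λ ⊆ L.support ∧ L.IsInvariant f ∧
    ∃ E : ∀ x : M, Submodule ℝ (TangentSpace (𝓡 m) x),
      IsSubbundleOn L.support d E ∧ L.IsTangentOn L.support E ∧ ∀ x ∈ Λ, E x = Eu x

/-- `h` is injective on the intersection of `Λ` with each strong unstable manifold. -/
def InjectiveOnLeaves [TopologicalSpace M] [ChartedSpace (EuclideanSpace ℝ (Fin m)) M] {d : ℕ}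
    {Γ : Type*} {Λ : Set M} (Fu : Lamination m M d) (h : Λ → Γ) : Prop :=
  ∀ x : Λ, InjOn h {y : Λ | (y : M) ∈ Fu.leaf x}

/-- The fibres of `h` are invariant under unstable holonomy. For `y` in the `ε`-local unstable leaf
of `x`, the holonomy from a neighbourhood of `x` in `F^cs_U(x) ∩ Λ` to `F^cs_U(y) ∩ Λ` sends `z` to
the point `z'` in which the local unstable leaf of `z` meets the local center-stable leaf of `y`;
invariance means that it sends points of the fibre of `x` to points of the fibre of `y`. -/
def FibresHolonomyInvariant [MetricSpace M] [ChartedSpace (EuclideanSpace ℝ (Fin m)) M]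
    {du dcs : ℕ} {Γ : Type*} {Λ : Set M} (U : Set M) (Fu : Lamination m M du)
    (Fcs : Lamination m M dcs) (h : Λ → Γ) : Prop :=
  ∃ ε : ℝ, 0 < ε ∧ ∀ x y : Λ, (y : M) ∈ Fu.localLeaf (Metric.ball x ε) x →
    ∃ δ : ℝ, 0 < δ ∧ ∀ z z' : Λ,
      (z : M) ∈ Fcs.localLeaf (U ∩ Metric.ball x δ) x →
      (z' : M) ∈ Fcs.localLeaf (U ∩ Metric.ball y ε) y →
      (z' : M) ∈ Fu.localLeaf (Metric.ball z ε) z →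
      h z = h x → h z' = h y

end Laminations

/-! The class `R` is compact and misses the closed set `Q`, which contains the frontiers of the
fibres. A small plaque of `Fcs` near `R` therefore cannot leave a fibre once it meets `Λ`: it lies
in one fibre (`Lamination.plaque_subset_fibre`), and so `h` sees only the displacement transverse to
`Ecs`. Given `p₁` and `p₂ ∈ Λ` close to a point of `R`, slide `p₂` inside its fibre until it differs
from `p₁`, in a chart, only along `Eu` (`Lamination.eventually_exists_slide`). A backward iterate
contracts `Eu`, so it halves the distance of the pair (`Lamination.eventually_exists_contraction`).

Repeating this, `uniform_contraction_of_step` shows that the backward iterates of `g` bring the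
images of all `δ`-close points of `R` together uniformly. The slid point may leave `R`, so the first
point of a pair is kept in `R` and the second one only in `Λ`. But `g⁻¹` maps `h(R)` onto itself, so
`h(R)` has no more points than there are small balls in a cover of `R`
(`finite_range_of_contraction`). Finally, a finite factor of a chain-recurrence class is a single
periodic orbit, since fine pseudo-orbits cannot jump between separated pieces
(`IsChainRecurrenceClass.exists_periodic_of_finite`).

The distance of `M` is tied to the Riemannian metric only through the topology, so lengths are
compared in a smooth Euclidean embedding `e`. -/

/-! ### Chain-recurrence classes and their finite factors -/

section ChainRecurrence

variable {X : Type*} [PseudoMetricSpace X] {f : X → X}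

/-- The end points of an `ε`-pseudo-orbit of length at least one. -/
def EpsChain (f : X → X) (ε : ℝ) (x y : X) : Prop :=
  ∃ (n : ℕ) (z : ℕ → X), 1 ≤ n ∧ z 0 = x ∧ z n = y ∧ ∀ i, i < n → dist (f (z i)) (z (i + 1)) < ε

theorem epsChain_iff_transGen {ε : ℝ} {x y : X} :
    EpsChain f ε x y ↔ Relation.TransGen (fun a b => dist (f a) b < ε) x y := by
  constructor
  · rintro ⟨n, z, hn, rfl, rfl, hz⟩
    induction n, hn using Nat.le_induction with
    | base => exact .single (hz 0 one_pos)
    | succ n hn ih => exact (ih fun i hi => hz i (by omega)).tail (hz n (by omega))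
  · intro h
    induction h with
    | single h => exact ⟨1, fun i => if i = 0 then x else _, le_rfl, rfl, rfl, by simpa using h⟩
    | @tail b c _ h ih =>
      obtain ⟨n, z, hn, h0, hb, hz⟩ := ih
      refine ⟨n + 1, fun i => if i ≤ n then z i else c, by omega, by simpa, by simp, fun i hi => ?_⟩
      rcases Nat.lt_succ_iff_lt_or_eq.1 hi with hi | rfl
      · simpa [hi.le, Nat.succ_le_of_lt hi] using hz i hi
      · simpa [hb] using h

theorem chainLeads_iff {x y : X} :
    ChainLeads f x y ↔ ∀ ε : ℝ, 0 < ε → Relation.TransGen (fun a b => dist (f a) b < ε) x y :=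
  forall₂_congr fun _ _ => epsChain_iff_transGen

theorem ChainLeads.trans {x y z : X} (h₁ : ChainLeads f x y) (h₂ : ChainLeads f y z) :
    ChainLeads f x z := by
  rw [chainLeads_iff] at *
  exact fun ε hε => (h₁ ε hε).trans (h₂ ε hε)

theorem chainLeads_apply (x : X) : ChainLeads f x (f x) :=
  chainLeads_iff.2 fun ε hε => .single (by simpa)

theorem transGen_dist_mono {ε ε' : ℝ} {x y : X} (hε : ε ≤ ε')
    (h : Relation.TransGen (fun a b => dist (f a) b < ε) x y) :
    Relation.TransGen (fun a b => dist (f a) b < ε') x y :=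
  h.lift id fun _ _ h => h.trans_le hε

theorem transGen_dist_of_dist_lt {ε δ : ℝ} {x y y' : X}
    (h : Relation.TransGen (fun a b => dist (f a) b < ε) x y) (hy : dist y y' < δ) :
    Relation.TransGen (fun a b => dist (f a) b < ε + δ) x y' := by
  have hδ : 0 < δ := dist_nonneg.trans_lt hy
  have mono : ∀ a b, dist (f a) b < ε → dist (f a) b < ε + δ := fun a b h => by linarith
  obtain ⟨c, h, h'⟩ := Relation.TransGen.tail'_iff.1 h
  exact .tail' (h.lift id mono) ((dist_triangle _ y _).trans_lt (add_lt_add h' hy))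

/-- A pseudo-orbit sees its initial point only through `f`, so only the first jump grows. -/
theorem transGen_dist_of_dist_lt_left {ε δ : ℝ} {x x' y : X}
    (h : Relation.TransGen (fun a b => dist (f a) b < ε) x y) (hx : dist (f x') (f x) < δ) :
    Relation.TransGen (fun a b => dist (f a) b < ε + δ) x' y := by
  have hδ : 0 < δ := dist_nonneg.trans_lt hx
  have mono : ∀ a b, dist (f a) b < ε → dist (f a) b < ε + δ := fun a b h => by linarith
  obtain ⟨c, h, h'⟩ := Relation.TransGen.head'_iff.1 h
  exact .head' ((dist_triangle _ (f x) _).trans_lt (by simp only [id]; linarith)) (h'.lift id mono)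

/-- A limit of points reached by ever finer pseudo-orbits is reached from `x`. -/
theorem chainLeads_of_frequently {x w : X}
    (h : ∀ ε > 0, ∀ δ > 0, ∃ y, dist y w < δ ∧
      Relation.TransGen (fun a b => dist (f a) b < ε) x y) : ChainLeads f x w := by
  refine chainLeads_iff.2 fun ε hε => ?_
  obtain ⟨y, hy, hxy⟩ := h (ε / 2) (by positivity) (ε / 2) (by positivity)
  refine transGen_dist_mono (add_halves ε).le <| transGen_dist_of_dist_lt hxy hy

theorem chainLeads_of_frequently_left (hf : Continuous f) {w y : X}
    (h : ∀ ε > 0, ∀ δ > 0, ∃ x, dist x w < δ ∧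
      Relation.TransGen (fun a b => dist (f a) b < ε) x y) : ChainLeads f w y := by
  refine chainLeads_iff.2 fun ε hε => ?_
  obtain ⟨δ, hδ, hfδ⟩ := Metric.continuousAt_iff.1 hf.continuousAt (ε / 2) (by positivity)
  obtain ⟨x, hx, hxy⟩ := h (ε / 2) (by positivity) δ hδ
  exact transGen_dist_mono (add_halves ε).le
    (transGen_dist_of_dist_lt_left hxy (by rw [dist_comm]; exact hfδ hx))

theorem mem_of_chainLeads {C : Set X} (hC : IsChainRecurrenceClass f C) {x y : X} (hx : x ∈ C)
    (hxy : ChainLeads f x y) (hyx : ChainLeads f y x) : y ∈ C := by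
  obtain ⟨a, ha, rfl⟩ := hC
  exact ⟨hyx.trans hxy, hx.2.1.trans hxy, hyx.trans hx.2.2⟩

theorem IsChainRecurrenceClass.chainLeads {C : Set X} (hC : IsChainRecurrenceClass f C) {x y : X}
    (hx : x ∈ C) (hy : y ∈ C) : ChainLeads f x y := by
  obtain ⟨a, ha, rfl⟩ := hC
  exact hx.2.2.trans hy.2.1

theorem IsChainRecurrenceClass.nonempty {C : Set X} (hC : IsChainRecurrenceClass f C) :
    C.Nonempty := by
  obtain ⟨a, ha, rfl⟩ := hC
  exact ⟨a, ha, ha, ha⟩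

theorem IsChainRecurrenceClass.eq_of_mem {C D : Set X} (hC : IsChainRecurrenceClass f C)
    (hD : IsChainRecurrenceClass f D) {x : X} (hx : x ∈ C) (hx' : x ∈ D) : C = D := by
  ext y
  exact ⟨fun hy => mem_of_chainLeads hD hx' (hC.chainLeads hx hy) (hC.chainLeads hy hx),
    fun hy => mem_of_chainLeads hC hx (hD.chainLeads hx' hy) (hD.chainLeads hy hx')⟩

theorem IsChainRecurrenceClass.isClosed {C : Set X} (hC : IsChainRecurrenceClass f C)
    (hf : Continuous f) : IsClosed C := by
  refine isClosed_of_closure_subset fun w hw => ?_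
  obtain ⟨x, hx⟩ := hC.nonempty
  rw [Metric.mem_closure_iff] at hw
  refine mem_of_chainLeads hC hx (chainLeads_of_frequently fun ε hε δ hδ => ?_)
    (chainLeads_of_frequently_left hf fun ε hε δ hδ => ?_)
  all_goals
    obtain ⟨y, hy, hwy⟩ := hw δ hδ
    refine ⟨y, by rwa [dist_comm], ?_⟩
  exacts [chainLeads_iff.1 (hC.chainLeads hx hy) ε hε, chainLeads_iff.1 (hC.chainLeads hy hx) ε hε]

theorem IsChainRecurrenceClass.map_mem {C : Set X} (hC : IsChainRecurrenceClass f C)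
    (hf : Continuous f) {x : X} (hx : x ∈ C) : f x ∈ C := by
  refine mem_of_chainLeads hC hx (chainLeads_apply x) (chainLeads_iff.2 fun ε hε => ?_)
  obtain ⟨δ, hδ, hfδ⟩ := Metric.continuousAt_iff.1 (hf.continuousAt (x := f x)) (ε / 2)
    (by positivity)
  have hxx := chainLeads_iff.1 (hC.chainLeads hx hx) (min δ (ε / 2)) (by positivity)
  obtain ⟨c, h, h'⟩ := Relation.TransGen.head'_iff.1 hxx
  -- If the loop has length one, then `c = x` and nothing remains after the first jump; a second
  -- turn around the loop keeps the chain nonempty.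
  have hcx := transGen_dist_mono (min_le_right δ (ε / 2)) (Relation.TransGen.trans_right h' hxx)
  refine transGen_dist_mono (add_halves ε).le <| transGen_dist_of_dist_lt_left (x' := f x) hcx <| by
    rw [dist_comm]
    exact hfδ (by rw [dist_comm]; exact h.trans_le (min_le_left _ _))

/-- Cut the last jump of a fine loop at `x`: the point before it has its image near `x`, hence is
itself near `f.symm x`. -/
theorem IsChainRecurrenceClass.symm_map_mem {f : X ≃ₜ X} {C : Set X}
    (hC : IsChainRecurrenceClass f C) {x : X} (hx : x ∈ C) : f.symm x ∈ C := by
  refine mem_of_chainLeads hC hx (chainLeads_iff.2 fun ε hε => ?_)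
    (by simpa using chainLeads_apply (f := f) (f.symm x))
  obtain ⟨δ, hδ, hfδ⟩ := Metric.continuousAt_iff.1 (f.symm.continuous.continuousAt (x := x)) (ε / 2)
    (by positivity)
  have hxx := chainLeads_iff.1 (hC.chainLeads hx hx) (min δ (ε / 2)) (by positivity)
  obtain ⟨c, h, h'⟩ := Relation.TransGen.tail'_iff.1 hxx
  have hxc := transGen_dist_mono (min_le_right δ (ε / 2)) (Relation.TransGen.trans_left hxx h)
  refine transGen_dist_mono (add_halves ε).le <| transGen_dist_of_dist_lt (y' := f.symm x) hxc <| by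
    simpa using hfδ (h'.trans_le (min_le_left _ _))

theorem IsChainRecurrenceClass.zpow_map_mem {f : X ≃ₜ X} {C : Set X}
    (hC : IsChainRecurrenceClass f C) {x : X} (hx : x ∈ C) (n : ℤ) : (f ^ n) x ∈ C := by
  induction n with
  | zero => simpa
  | succ n ih =>
    rw [add_comm, zpow_add, zpow_one]
    exact hC.map_mem f.continuous ih
  | pred n ih =>
    rw [sub_eq_add_neg, add_comm, zpow_add, zpow_neg_one]
    exact hC.symm_map_mem ih

/-- Fine pseudo-orbits between points of a chain-recurrence class stay close to the class. -/
theorem IsChainRecurrenceClass.exists_chain_near [CompactSpace X] {C : Set X}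
    (hC : IsChainRecurrenceClass f C) (hf : Continuous f) {x : X} (hx : x ∈ C) {V : Set X}
    (hV : IsOpen V) (hCV : C ⊆ V) :
    ∃ ε > 0, ∀ w, Relation.TransGen (fun a b => dist (f a) b < ε) x w →
      Relation.TransGen (fun a b => dist (f a) b < ε) w x → w ∈ V := by
  by_contra! H
  choose! w hxw hwx hwV using fun n : ℕ => H (1 / (n + 1 : ℝ)) (by positivity)
  obtain ⟨a, -, φ, hφ, hlim⟩ := isCompact_univ.tendsto_subseq (x := w) fun _ => mem_univ _
  have key : ∀ ε > 0, ∀ δ > 0, ∃ n : ℕ, (1 / (n + 1 : ℝ)) < ε ∧ dist (w n) a < δ := by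
    intro ε hε δ hδ
    obtain ⟨k, h1, h2⟩ := ((tendsto_one_div_add_atTop_nhds_zero_nat.comp
      hφ.tendsto_atTop).eventually_lt_const hε |>.and
        (Metric.tendsto_nhds.1 hlim δ hδ)).exists
    exact ⟨φ k, h1, h2⟩
  -- The loops from `x` through `w n` become arbitrarily fine, so their limit point is
  -- chain-equivalent to `x`.
  have ha : a ∈ C := by
    refine mem_of_chainLeads hC hx (chainLeads_of_frequently fun ε hε δ hδ => ?_)
      (chainLeads_of_frequently_left hf fun ε hε δ hδ => ?_)
    all_goals
      obtain ⟨n, hn, hd⟩ := key ε hε δ hδ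
      refine ⟨w n, hd, ?_⟩
    exacts [transGen_dist_mono hn.le (hxw n), transGen_dist_mono hn.le (hwx n)]
  obtain ⟨k, hk⟩ := (hlim.eventually (hV.mem_nhds (hCV ha))).exists
  exact hwV _ hk

/-- A continuous image of a chain-recurrence class that is finite is a single periodic orbit. -/
theorem IsChainRecurrenceClass.exists_periodic_of_finite [CompactSpace X] {C : Set X}
    (hC : IsChainRecurrenceClass f C) (hf : Continuous f) {Γ : Type*} [TopologicalSpace Γ]
    [T1Space Γ] {g : Γ → Γ} (hg : Function.Injective g) {h : C → Γ} (hh : Continuous h)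
    (hsemi : ∀ x : C, g (h x) = h ⟨f x, hC.map_mem hf x.2⟩) (hfin : (range h).Finite) :
    ∃ p ∈ Function.periodicPts g, ∀ x : C, ∃ k : ℕ, h x = g^[k] p := by
  obtain ⟨x₀, hx₀⟩ := hC.nonempty
  have hmaps : MapsTo g (range h) (range h) := by
    rintro _ ⟨x, rfl⟩
    exact ⟨_, (hsemi x).symm⟩
  have hper : h ⟨x₀, hx₀⟩ ∈ Function.periodicPts g := by
    have : Finite (range h) := hfin
    have hinj : Function.Injective (hmaps.restrict g _ _) := hmaps.restrict_inj.2 hg.injOn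
    obtain ⟨n, hn, hp⟩ := hinj.mem_periodicPts ⟨h ⟨x₀, hx₀⟩, mem_range_self _⟩
    refine ⟨n, hn, ?_⟩
    have := congrArg Subtype.val hp
    rwa [MapsTo.iterate_restrict] at this
  refine ⟨_, hper, ?_⟩
  set O : Set Γ := range fun k : ℕ => g^[k] (h ⟨x₀, hx₀⟩) with hO
  have hgO : ∀ y, y ∈ O → g y ∈ O := by
    rintro _ ⟨k, rfl⟩
    exact ⟨k + 1, by simp [Function.iterate_succ_apply']⟩
  -- Finiteness enters here: only the finite set `S ∩ range h` matters, so every preimage is closed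
  -- and `A`, `B` lie at positive distance.
  have hclosed : ∀ S : Set Γ, IsClosed (Subtype.val '' (h ⁻¹' S)) := fun S => by
    refine (hC.isClosed hf).isClosedEmbedding_subtypeVal.isClosedMap _ ?_
    rw [← preimage_inter_range]
    exact (hfin.subset inter_subset_right).isClosed.preimage hh
  set A : Set X := Subtype.val '' (h ⁻¹' O)
  set B : Set X := Subtype.val '' (h ⁻¹' Oᶜ)
  have hAB : Disjoint A B := by
    rw [Set.disjoint_left]
    rintro _ ⟨x, hx, rfl⟩ ⟨y, hy, hxy⟩
    exact hy (by rw [Subtype.ext hxy]; exact hx)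
  have hCAB : C ⊆ A ∪ B := fun x hx => by
    by_cases hxO : h ⟨x, hx⟩ ∈ O
    exacts [.inl ⟨_, hxO, rfl⟩, .inr ⟨_, hxO, rfl⟩]
  have hfA : ∀ x ∈ A, f x ∈ A := by
    rintro _ ⟨x, hx, rfl⟩
    exact ⟨⟨f x, hC.map_mem hf x.2⟩, by rw [mem_preimage, ← hsemi]; exact hgO _ hx, rfl⟩
  obtain ⟨δ, hδ, hdisj⟩ := hAB.exists_thickenings (hclosed O).isCompact (hclosed Oᶜ)
  obtain ⟨δ', hδ', hfδ⟩ := Metric.uniformContinuous_iff.1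
    (CompactSpace.uniformContinuous_of_continuous hf) (δ / 2) (by positivity)
  -- One jump degrades the distance to `A` from `min δ δ'` to `δ`. Being near `C` and away from `B`
  -- restores the smaller radius, so errors do not accumulate.
  have hsub : ∀ w, w ∈ Metric.thickening (min δ δ') C →
      w ∉ Metric.thickening δ B → w ∈ Metric.thickening (min δ δ') A := by
    intro w hw hwB
    obtain ⟨c, hc, hwc⟩ := Metric.mem_thickening_iff.1 hw
    rcases hCAB hc with hc | hc
    · exact Metric.mem_thickening_iff.2 ⟨c, hc, hwc⟩
    · exact absurd (Metric.mem_thickening_iff.2 ⟨c, hc, hwc.trans_le (min_le_left _ _)⟩) hwB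
  obtain ⟨ε, hε, hnear⟩ := hC.exists_chain_near hf hx₀ Metric.isOpen_thickening
    (Metric.self_subset_thickening (show 0 < min δ δ' by positivity) C)
  intro y
  obtain ⟨hy₀, hy₁⟩ := And.intro (chainLeads_iff.1 (hC.chainLeads hx₀ y.2) (min ε (δ / 2))
    (by positivity)) (chainLeads_iff.1 (hC.chainLeads y.2 hx₀) (min ε (δ / 2)) (by positivity))
  have hx₀A : x₀ ∈ A := ⟨⟨x₀, hx₀⟩, ⟨0, rfl⟩, rfl⟩
  have hstep : ∀ b c, b ∈ Metric.thickening (min δ δ') A → dist (f b) c < min ε (δ / 2) →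
      c ∈ Metric.thickening δ A := by
    intro b c hb hbc
    obtain ⟨a, ha, hba⟩ := Metric.mem_thickening_iff.1 hb
    refine Metric.mem_thickening_iff.2 ⟨f a, hfA a ha, ?_⟩
    have h1 := hfδ (hba.trans_le (min_le_right _ _))
    have h2 := hbc.trans_le (min_le_right _ _)
    rw [dist_comm] at h2
    linarith [dist_triangle c (f b) (f a)]
  -- The remaining chain from `w` to `y` is carried along because `hnear` needs `w` on a loop
  -- through `x₀`, which `hy₁` closes up.
  have hind : ∀ w, Relation.TransGen (fun a b => dist (f a) b < min ε (δ / 2)) x₀ w →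
      Relation.ReflTransGen (fun a b => dist (f a) b < min ε (δ / 2)) w y →
      w ∈ Metric.thickening (min δ δ') A := by
    intro w hw
    have hV : ∀ w, Relation.TransGen (fun a b => dist (f a) b < min ε (δ / 2)) x₀ w →
        Relation.ReflTransGen (fun a b => dist (f a) b < min ε (δ / 2)) w y →
        w ∈ Metric.thickening δ A → w ∈ Metric.thickening (min δ δ') A := fun w h₁ h₂ h₃ =>
      hsub w (hnear w (transGen_dist_mono (min_le_left _ _) h₁)
        (transGen_dist_mono (min_le_left _ _) (Relation.TransGen.trans_right h₂ hy₁)))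
        (Set.disjoint_left.1 hdisj h₃)
    induction hw with
    | single h =>
      exact fun hwy => hV _ (.single h) hwy
        (hstep _ _ (Metric.self_subset_thickening (by positivity) A hx₀A) h)
    | tail h h' ih => exact fun hwy => hV _ (h.tail h') hwy (hstep _ _ (ih (.head h' hwy)) h')
  have hyA := hind y hy₀ .refl
  have hyO : h y ∈ O := by
    by_contra hyO
    exact Set.disjoint_left.1 hdisj (Metric.thickening_mono (min_le_left _ _) _ hyA)
      (Metric.self_subset_thickening hδ B ⟨y, hyO, rfl⟩)
  obtain ⟨k, hk⟩ := hyO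
  exact ⟨k, hk.symm⟩

end ChainRecurrence

/-! ### Contraction at a fixed scale forces finiteness -/

section BackwardContraction

variable {Y Γ : Type*} [MetricSpace Γ]

/-- If nearby points of a compact space have images that are contracted by the iterates of `G`,
and these iterates map the image onto itself, then the image is finite. -/
theorem finite_range_of_contraction [PseudoMetricSpace Y] [CompactSpace Y] {h : Y → Γ} {G : Γ → Γ}
    (hG : ∀ n : ℕ, ∀ y : Y, ∃ z : Y, G^[n] (h z) = h y) {δ : ℝ} (hδ : 0 < δ)
    (H : ∀ η > 0, ∃ n : ℕ, ∀ z z' : Y, dist z z' < δ → dist (G^[n] (h z)) (G^[n] (h z')) < η) :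
    (range h).Finite := by
  obtain ⟨t, -, ht, hcov⟩ := finite_cover_balls_of_compact (isCompact_univ (X := Y)) (half_pos hδ)
  by_contra hinf
  obtain ⟨s, hs, hcard⟩ := Set.Infinite.exists_subset_card_eq hinf (ht.toFinset.card + 1)
  -- There is one more point in `s` than balls of radius `δ / 2`. With `η` below their separation,
  -- two preimages under `G^[n]` in the same ball give a contradiction.
  have hsep : ∀ᶠ η : ℝ in 𝓝[>] 0, ∀ p ∈ s.offDiag, η < dist p.1 p.2 := by
    refine (Filter.eventually_all_finset _).2 fun p hp => nhdsWithin_le_nhds ?_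
    exact eventually_lt_nhds (dist_pos.2 (Finset.mem_offDiag.1 hp).2.2)
  obtain ⟨η, hη, hη0⟩ := (hsep.and self_mem_nhdsWithin).exists
  obtain ⟨n, hn⟩ := H η hη0
  have hz : ∀ y ∈ s, ∃ z : Y, G^[n] (h z) = y := by
    intro y hy
    obtain ⟨w, rfl⟩ := hs hy
    exact hG n w
  obtain ⟨y₀, hy₀⟩ := Finset.card_pos.1 (by omega : 0 < s.card)
  have : Nonempty Y := (hs hy₀).nonempty
  choose! z hz using hz
  have hc : ∀ w : Y, ∃ c ∈ t, dist w c < δ / 2 := fun w => by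
    simpa using hcov (mem_univ w)
  choose c hct hc using hc
  obtain ⟨y, hy, y', hy', hne, heq⟩ := Finset.exists_ne_map_eq_of_card_lt_of_maps_to
    (s := s) (t := ht.toFinset) (f := fun y => c (z y)) (by omega) (fun y _ => by simp [hct])
  have h1 := hc (z y)
  have h2 := hc (z y')
  rw [← heq] at h2
  have h3 := hn (z y) (z y') (by linarith [dist_triangle_right (z y) (z y') (c (z y))])
  rw [hz y hy, hz y' hy'] at h3
  exact lt_asymm h3 (hη (y, y') (by simp [hy, hy', hne]))

/-- If every close pair can be brought closer by a factor two in bounded time, up to moving the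
second point inside its fibre, then images of close pairs are uniformly contracted. -/
theorem uniform_contraction_of_step {F : Y → Y} {G : Γ → Γ} {h : Y → Γ}
    (hsemi : ∀ y, h (F y) = G (h y)) {R : Set Y} (hR : MapsTo F R R) {σ : Y → Y → ℝ} {K : ℕ}
    {δ : ℝ}
    (hstep : ∀ z ∈ R, ∀ z', σ z z' < δ → ∃ N, 0 < N ∧ N ≤ K ∧ ∃ z'', h z'' = h z' ∧
      σ (F^[N] z) (F^[N] z'') ≤ σ z z' / 2)
    (hσ : ∀ η > 0, ∀ i : ℕ, ∃ s > 0, ∀ z z', σ z z' < s → dist (G^[i] (h z)) (G^[i] (h z')) < η)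
    (hσ₀ : ∀ z z', 0 ≤ σ z z') (hδ : 0 < δ) {η : ℝ} (hη : 0 < η) :
    ∃ n₀ : ℕ, ∀ n ≥ n₀, ∀ z ∈ R, ∀ z', σ z z' < δ → dist (G^[n] (h z)) (G^[n] (h z')) < η := by
  have hiter : ∀ n y, h (F^[n] y) = G^[n] (h y) := fun n =>
    (Function.Semiconj.iterate_right (show Function.Semiconj h F G from hsemi) n)
  have hRn : ∀ n, MapsTo F^[n] R R := fun n => hR.iterate n
  -- Below `s`, continuity alone controls the fewer than `K` iterates left over after the last step.
  obtain ⟨s, hs0, hs⟩ : ∃ s > 0, ∀ i < K, ∀ z z', σ z z' < s →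
      dist (G^[i] (h z)) (G^[i] (h z')) < η := by
    choose s hs0 hs using hσ η hη
    have : ∀ᶠ r : ℝ in 𝓝[>] 0, ∀ i ∈ Finset.range K, r < s i :=
      (Filter.eventually_all_finset _).2 fun i _ => nhdsWithin_le_nhds (eventually_lt_nhds (hs0 i))
    obtain ⟨r, hr, hr0⟩ := (this.and self_mem_nhdsWithin).exists
    exact ⟨r, hr0, fun i hi z z' hz => hs i z z' (hz.trans (hr i (by simpa)))⟩
  have hsub : ∀ n N : ℕ, N ≤ n → ∀ y, G^[n] y = G^[n - N] (G^[N] y) := fun n N hN y => by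
    rw [← Function.iterate_add_apply, Nat.sub_add_cancel hN]
  -- A step never increases `σ`, so pairs below `min δ s` remain there; since `0 < N`, the strong
  -- induction descends.
  have hbase : ∀ n : ℕ, ∀ z ∈ R, ∀ z', σ z z' < min δ s →
      dist (G^[n] (h z)) (G^[n] (h z')) < η := by
    intro n
    induction n using Nat.strong_induction_on with
    | _ n ih =>
      intro z hz z' hzz'
      by_cases hn : n < K
      · exact hs n hn z z' (hzz'.trans_le (min_le_right _ _))
      · obtain ⟨N, hN0, hNK, z'', hz'', hle⟩ := hstep z hz z' (hzz'.trans_le (min_le_left _ _))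
        have := ih (n - N) (by omega) _ (hRn N hz) (F^[N] z'')
          (hle.trans_lt ((half_le_self (hσ₀ _ _)).trans_lt hzz'))
        rwa [hiter, hiter, ← hsub n N (by omega), ← hsub n N (by omega), hz''] at this
  -- A step costs at most `K` iterates and halves `σ`, so `j` steps bring `σ` from `2 ^ j * min δ s`
  -- down to the range of `hbase`.
  have hind : ∀ j : ℕ, ∀ n ≥ j * K, ∀ z ∈ R, ∀ z', σ z z' < δ → σ z z' < 2 ^ j * min δ s →
      dist (G^[n] (h z)) (G^[n] (h z')) < η := by
    intro j
    induction j with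
    | zero => exact fun n _ z hz z' _ hzz' => hbase n z hz z' (by simpa using hzz')
    | succ j ih =>
      intro n hn z hz z' hzz' hzz'2
      obtain ⟨N, hN0, hNK, z'', hz'', hle⟩ := hstep z hz z' hzz'
      rw [add_mul, one_mul] at hn
      rw [pow_succ] at hzz'2
      have := ih (n - N) (by omega) _ (hRn N hz) (F^[N] z'')
        (hle.trans_lt ((half_le_self (hσ₀ _ _)).trans_lt hzz')) (by linarith)
      rwa [hiter, hiter, ← hsub n N (by omega), ← hsub n N (by omega), hz''] at this
  obtain ⟨j, hj⟩ := pow_unbounded_of_one_lt (δ / min δ s) (one_lt_two (α := ℝ))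
  rw [div_lt_iff₀ (by positivity)] at hj
  exact ⟨j * K, fun n hn z hz z' hzz' => hind j n hn z hz z' hzz' (hzz'.trans hj)⟩

end BackwardContraction

/-! ### Intersecting discs with transverse affine subspaces -/

section Transversals

variable {V W E : Type*} [NormedAddCommGroup V] [NormedSpace ℝ V] [NormedAddCommGroup W]
  [NormedSpace ℝ W] [NormedAddCommGroup E] [NormedSpace ℝ E]

/-- A disc `Ψ`, tangent to thin cones around a complement of `ker P`, that passes close to `y`
meets `y + ker P` at a point whose displacement along `q` is small. -/
theorem exists_mem_fiber_of_cone [ProperSpace V] {P : E →L[ℝ] W} {q : E →L[ℝ] E} {Ψ : V → E}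
    {v₀ v' : V} {r κ ε : ℝ} (hκ : 0 ≤ κ) (hκε : κ * ε < 1)
    (hΨ : ContinuousOn Ψ (Metric.closedBall v₀ r))
    (hderiv : ∀ v ∈ Metric.ball v₀ r, ∃ J : V →L[ℝ] E, HasFDerivAt Ψ J v ∧
      ∀ a : W, ∃ ξ, P (J ξ) = a ∧ ‖q (J ξ)‖ ≤ ε * ‖a‖)
    (hv' : v' ∈ Metric.ball v₀ r) {y : E}
    (hbdry : ∀ v ∈ Metric.sphere v₀ r,
      ‖P (Ψ v' - y)‖ < ‖P (Ψ v - y)‖ + κ * ‖q (Ψ v - Ψ v')‖) :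
    ∃ v ∈ Metric.ball v₀ r, P (Ψ v - y) = 0 ∧ κ * ‖q (Ψ v - Ψ v')‖ ≤ ‖P (Ψ v' - y)‖ := by
  -- A variational substitute for the implicit function theorem, as the derivative is only
  -- controlled pointwise through cones. The boundary condition makes a minimiser of `F` interior;
  -- there the first term must vanish, since otherwise it could be decreased faster than the second
  -- one grows.
  set F : V → ℝ := fun v => ‖P (Ψ v - y)‖ + κ * ‖q (Ψ v - Ψ v')‖ with hF
  have hFc : ContinuousOn F (Metric.closedBall v₀ r) := by fun_prop
  obtain ⟨v, hv, hmin⟩ := (isCompact_closedBall v₀ r).exists_isMinOn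
    ⟨v', Metric.ball_subset_closedBall hv'⟩ hFc
  have hFv' : F v ≤ ‖P (Ψ v' - y)‖ := by
    have := hmin (Metric.ball_subset_closedBall hv')
    simpa [hF] using this
  have hvb : v ∈ Metric.ball v₀ r := by
    rcases (Metric.mem_closedBall.1 hv).lt_or_eq with h | h
    · exact h
    · exact absurd (hbdry v h) (not_lt.2 hFv')
  have hκ0 : 0 ≤ κ * ‖q (Ψ v - Ψ v')‖ := by positivity
  refine ⟨v, hvb, ?_, le_trans (by simp [hF]) hFv'⟩
  by_contra hne
  set ρ := ‖P (Ψ v - y)‖ with hρ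
  have hρ0 : 0 < ρ := norm_pos_iff.2 hne
  obtain ⟨J, hJ, hcone⟩ := hderiv v hvb
  obtain ⟨ξ, hξ, hqξ⟩ := hcone (-(P (Ψ v - y)))
  rw [norm_neg, ← hρ] at hqξ
  -- along `v + t ξ` the first term decreases at unit rate, the second grows more slowly
  have hline : HasDerivAt (fun t : ℝ => Ψ (v + t • ξ)) (J ξ) 0 := by
    have h1 : HasDerivAt (fun t : ℝ => v + t • ξ) ξ 0 := by
      simpa using ((hasDerivAt_id (0 : ℝ)).smul_const ξ).const_add v
    exact HasFDerivAt.comp_hasDerivAt (0 : ℝ) (by simpa using hJ) h1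
  set c := (1 - κ * ε) * ρ with hc
  have hc0 : 0 < c := mul_pos (by linarith) hρ0
  -- Chosen so that the linearisation error uses at most half of the decay rate `c`.
  set b := c / (2 * (‖P‖ + κ * ‖q‖ + 1)) with hb
  have hb0 : 0 < b := by positivity
  have hsmall : ∀ᶠ t : ℝ in 𝓝 0, ‖Ψ (v + t • ξ) - Ψ v - t • J ξ‖ ≤ b * ‖t‖ := by
    have := (hasDerivAt_iff_isLittleO.1 hline).def hb0
    simpa using this
  have hball : ∀ᶠ t : ℝ in 𝓝 0, v + t • ξ ∈ Metric.ball v₀ r := by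
    have : Continuous fun t : ℝ => v + t • ξ := by fun_prop
    exact this.continuousAt.eventually_mem (by simpa using Metric.isOpen_ball.mem_nhds hvb)
  obtain ⟨t, ⟨⟨ht, htb⟩, ht1⟩, ht0⟩ :=
    ((((hsmall.and hball).and (eventually_lt_nhds one_pos)).filter_mono
    nhdsWithin_le_nhds).and (self_mem_nhdsWithin (s := Ioi (0 : ℝ)))).exists
  have ht0 : 0 < t := ht0
  have hmin' : F v ≤ F (v + t • ξ) := hmin (Metric.ball_subset_closedBall htb)
  set d := Ψ (v + t • ξ) - Ψ v - t • J ξ with hd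
  rw [Real.norm_of_nonneg ht0.le] at ht
  have e1 : P (Ψ (v + t • ξ) - y) = (1 - t) • P (Ψ v - y) + P d := by
    have : Ψ (v + t • ξ) - y = (Ψ v - y) + t • J ξ + d := by rw [hd]; abel
    rw [this, map_add, map_add, map_smul, hξ]
    module
  have e2 : q (Ψ (v + t • ξ) - Ψ v') = q (Ψ v - Ψ v') + t • q (J ξ) + q d := by
    have : Ψ (v + t • ξ) - Ψ v' = (Ψ v - Ψ v') + t • J ξ + d := by rw [hd]; abel
    rw [this, map_add, map_add, map_smul]
  have n1 : ‖P (Ψ (v + t • ξ) - y)‖ ≤ (1 - t) * ρ + ‖P‖ * (b * t) := by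
    rw [e1]
    refine (norm_add_le _ _).trans (add_le_add ?_ ((P.le_opNorm _).trans (by gcongr)))
    rw [norm_smul, Real.norm_of_nonneg (by linarith)]
  have n2 : ‖q (Ψ (v + t • ξ) - Ψ v')‖ ≤ ‖q (Ψ v - Ψ v')‖ + t * (ε * ρ) + ‖q‖ * (b * t) := by
    rw [e2]
    refine (norm_add_le _ _).trans (add_le_add ((norm_add_le _ _).trans (add_le_add le_rfl ?_))
      ((q.le_opNorm _).trans (by gcongr)))
    rw [norm_smul, Real.norm_of_nonneg ht0.le]
    gcongr
  have n3 := mul_le_mul_of_nonneg_left n2 hκ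
  have hbc : (‖P‖ + κ * ‖q‖) * b ≤ c / 2 := by
    rw [hb, mul_div_assoc', div_le_div_iff₀ (by positivity) two_pos]
    nlinarith [norm_nonneg P, mul_nonneg hκ (norm_nonneg q)]
  have n4 : (‖P‖ + κ * ‖q‖) * b * t ≤ c / 2 * t := by gcongr
  simp only [hF] at hmin'
  have n5 : c * t ≤ c / 2 * t := by rw [hc] at *; linarith
  nlinarith [mul_pos hc0 ht0]

/-- The projection onto the range of an injective map along a complement. -/
theorem exists_leftInverse_ker_eq [FiniteDimensional ℝ E] [FiniteDimensional ℝ V] {S : V →L[ℝ] E}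
    (hS : Function.Injective S) {A : Submodule ℝ E} (hA : IsCompl S.toLinearMap.range A) :
    ∃ P : E →L[ℝ] V, (∀ v, P (S v) = v) ∧ ∀ w, P w = 0 ↔ w ∈ A := by
  set e := LinearEquiv.ofInjective S.toLinearMap hS
  refine ⟨LinearMap.toContinuousLinearMap
    (e.symm.toLinearMap ∘ₗ Submodule.projectionOnto _ A hA), fun v => ?_, fun w => ?_⟩
  · have : S v = (e v : E) := rfl
    simp [this, Submodule.projectionOnto_apply_left]
  · simp [Submodule.projectionOnto_apply_eq_zero_iff]

/-- The graph of a small perturbation of `S` lies in thin cones around the range of `S`. -/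
theorem eventually_cone_of_tendsto [FiniteDimensional ℝ V] {ι : Type*} {l : Filter ι}
    {S : ι → V →L[ℝ] E} {S₀ : V →L[ℝ] E} (hS : Tendsto S l (𝓝 S₀)) {P : E →L[ℝ] V}
    (hP : ∀ v, P (S₀ v) = v) {ε : ℝ} (hε : 0 < ε) :
    ∀ᶠ i in l, ∀ a : V, ∃ b, P (S i b) = a ∧ ‖S i b - S₀ a‖ ≤ ε * ‖a‖ := by
  -- Since `P ∘L S i` tends to the identity, it is eventually invertible, and its inverse applied to
  -- `a` is the required `b`.
  have h1 : Tendsto (fun i => P ∘L S i) l (𝓝 (1 : V →L[ℝ] V)) := by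
    have : P ∘L S₀ = 1 := by ext v; simp [hP]
    rw [← this]
    exact ((ContinuousLinearMap.compL ℝ V E V P).continuous.tendsto S₀).comp hS
  have h2 : ∀ᶠ i in l, IsUnit (P ∘L S i) := h1.eventually
    (Units.isOpen.mem_nhds isUnit_one)
  have h3 : Tendsto (fun i => S i ∘L Ring.inverse (P ∘L S i) - S₀) l (𝓝 0) := by
    have hinv : Tendsto (fun i => Ring.inverse (P ∘L S i)) l (𝓝 (1 : V →L[ℝ] V)) := by
      have := (NormedRing.inverse_continuousAt (1 : (V →L[ℝ] V)ˣ)).tendsto.comp h1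
      simpa [Function.comp_def] using this
    have := (((ContinuousLinearMap.compL ℝ V V E).continuous₂.tendsto (S₀, 1)).comp
      (hS.prodMk_nhds hinv)).sub_const S₀
    simpa [ContinuousLinearMap.one_def] using this
  filter_upwards [h2, h3.norm.eventually_le_const (by simpa using hε)] with i hi hle a
  refine ⟨Ring.inverse (P ∘L S i) a, ?_, ?_⟩
  · have := congrArg (fun T : V →L[ℝ] V => T a) (Ring.mul_inverse_cancel _ hi)
    simpa using this
  · simpa using (ContinuousLinearMap.le_of_opNorm_le _ hle a)

end Transversals

/-! ### Plaques inside fibres -/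

theorem mem_fibre_iff {X Γ : Type*} {Λ : Set X} {h : Λ → Γ} {y : Γ} {z : X} :
    z ∈ fibre h y ↔ ∃ hz : z ∈ Λ, h ⟨z, hz⟩ = y := by
  simp [fibre]

section Plaques

/-- The image of `D` is connected, so it stays in one component of leaf and `U`. If it met both `A`
and its complement it would cross the relative frontier of `A`, hence `Q`. -/
theorem map_mem_of_relFrontier_subset {X Y : Type*} [TopologicalSpace X] [t : TopologicalSpace Y]
    {c : X → Y} (hc : Continuous c) {D : Set X} (hD : IsPreconnected D) {U Q A : Set Y}
    (hU : ∀ v ∈ D, c v ∈ U) (hQ : ∀ v ∈ D, c v ∉ Q) {v₀ v : X} (hv₀ : v₀ ∈ D) (hv : v ∈ D)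
    (hA : c v₀ ∈ A)
    (hfr : relFrontier t (connectedComponentIn (connectedComponent (c v₀) ∩ U) (c v₀)) A ⊆ Q) :
    c v ∈ A := by
  set P := connectedComponentIn (connectedComponent (c v₀) ∩ U) (c v₀)
  have hB : IsPreconnected (c '' D) := hD.image c hc.continuousOn
  have hx : c v₀ ∈ c '' D := mem_image_of_mem _ hv₀
  have hBP : c '' D ⊆ P := by
    refine hB.subset_connectedComponentIn hx
      (subset_inter (hB.subset_connectedComponent hx) ?_)
    rintro _ ⟨w, hw, rfl⟩
    exact hU w hw
  by_contra hvA
  obtain ⟨_, ⟨u, hu, rfl⟩, hw₁, hw₂⟩ := isPreconnected_closed_iff.1 hB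
    (closure (P ∩ A)) (closure (P \ A)) isClosed_closure isClosed_closure
    (fun w hw => by
      by_cases hwA : w ∈ A
      exacts [.inl (subset_closure ⟨hBP hw, hwA⟩), .inr (subset_closure ⟨hBP hw, hwA⟩)])
    ⟨_, hx, subset_closure ⟨hBP hx, hA⟩⟩
    ⟨_, mem_image_of_mem _ hv, subset_closure ⟨hBP (mem_image_of_mem _ hv), hvA⟩⟩
  exact hQ u hu (hfr ⟨⟨hBP (mem_image_of_mem _ hu), hw₁⟩, hw₂⟩)

variable {m : ℕ} {M : Type u} [TopologicalSpace M] [ChartedSpace (EuclideanSpace ℝ (Fin m)) M]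
  {d : ℕ}

theorem Lamination.continuous_plaque (L : Lamination m M d) {φ : FlowBox m M d L.support}
    (hφ : φ ∈ L.boxes) (s : φ.T) : Continuous[inferInstance, L.leafTopology] (φ.toFun s) :=
  @Continuous.mk _ _ _ L.leafTopology _ fun _ hA => hA φ hφ s

/-- A connected piece of a plaque that avoids the frontiers of the fibres and meets `Λ` is contained
in a fibre. -/
theorem Lamination.plaque_subset_fibre (L : Lamination m M d) {U Q Λ : Set M} {Γ : Type*}
    {h : Λ → Γ}
    (hfib : ∀ x : Λ, relFrontier L.leafTopology (L.localLeaf U x) (fibre h (h x)) ⊆ Q)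
    {φ : FlowBox m M d L.support} (hφ : φ ∈ L.boxes) {s : φ.T}
    {D : Set (EuclideanSpace ℝ (Fin d))} (hD : IsPreconnected D)
    (hU : ∀ v ∈ D, φ.toFun s v ∈ U) (hQ : ∀ v ∈ D, φ.toFun s v ∉ Q)
    {v₀ v : EuclideanSpace ℝ (Fin d)} (hv₀ : v₀ ∈ D) (hv : v ∈ D) (hΛ : φ.toFun s v₀ ∈ Λ) :
    φ.toFun s v ∈ fibre h (h ⟨_, hΛ⟩) :=
  @map_mem_of_relFrontier_subset _ M _ L.leafTopology _ (L.continuous_plaque hφ s) D hD U Q _ hU hQ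
    v₀ v hv₀ hv (mem_fibre_iff.2 ⟨hΛ, rfl⟩) (hfib ⟨_, hΛ⟩)

end Plaques

/-! ### Subbundles read in a chart -/

section Frames

variable {m : ℕ} {M : Type u} [TopologicalSpace M] [ChartedSpace (EuclideanSpace ℝ (Fin m)) M]
  [IsManifold (𝓡 m) 1 M] {d : ℕ}

/-- The derivative at `w` of the preferred chart at `x`. -/
noncomputable def chartDeriv (m : ℕ) {M : Type u} [TopologicalSpace M]
    [ChartedSpace (EuclideanSpace ℝ (Fin m)) M] (x w : M) :
    TangentSpace (𝓡 m) w →L[ℝ] EuclideanSpace ℝ (Fin m) :=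
  mfderiv (𝓡 m) 𝓘(ℝ, EuclideanSpace ℝ (Fin m)) (extChartAt (𝓡 m) x) w

theorem trivializationAt_tangentBundle_snd {x w : M}
    (hw : w ∈ (chartAt (EuclideanSpace ℝ (Fin m)) x).source) (v : TangentSpace (𝓡 m) w) :
    (trivializationAt (EuclideanSpace ℝ (Fin m)) (TangentSpace (𝓡 m)) x
      (⟨w, v⟩ : TangentBundle (𝓡 m) M)).2 = chartDeriv m x w v := by
  rw [chartDeriv, ← TangentBundle.continuousLinearMapAt_trivializationAt (𝕜 := ℝ) hw,
    Trivialization.continuousLinearMapAt_apply, Trivialization.coe_linearMapAt_of_mem]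
  simpa using hw

theorem chartDeriv_injective {x w : M} (hw : w ∈ (extChartAt (𝓡 m) x).source) :
    Function.Injective (chartDeriv m x w) := by
  obtain ⟨e, he⟩ := isInvertible_mfderiv_extChartAt (I := 𝓡 m) hw
  intro a b hab
  refine e.injective ?_
  rw [← ContinuousLinearEquiv.coe_coe, he]
  exact hab

theorem chartDeriv_surjective {x w : M} (hw : w ∈ (extChartAt (𝓡 m) x).source) :
    Function.Surjective (chartDeriv m x w) := by
  obtain ⟨e, he⟩ := isInvertible_mfderiv_extChartAt (I := 𝓡 m) hw
  rw [chartDeriv, ← he]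
  exact e.surjective

/-- In a single chart the planes `E w` are described by linear maps between fixed spaces, which can
be compared in operator norm as `w` varies. -/
theorem IsSubbundleOn.exists_frame {Λ : Set M} {E : ∀ x : M, Submodule ℝ (TangentSpace (𝓡 m) x)}
    (hE : IsSubbundleOn Λ d E) {x : M} (hx : x ∈ Λ) :
    ∃ S : M → EuclideanSpace ℝ (Fin d) →L[ℝ] EuclideanSpace ℝ (Fin m),
      Tendsto S (𝓝[Λ] x) (𝓝 (S x)) ∧ Function.Injective (S x) ∧
      (S x).toLinearMap.range = (E x).map (chartDeriv m x x).toLinearMap ∧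
      ∀ᶠ w in 𝓝[Λ] x, ∀ b, ∃ ζ ∈ E w, chartDeriv m x w ζ = S w b := by
  obtain ⟨W, hW, s, hs, hspan⟩ := hE x hx
  obtain ⟨hli, hsp⟩ := hspan x ⟨hx, mem_of_mem_nhds hW⟩
  have hinj := chartDeriv_injective (mem_extChartAt_source (I := 𝓡 m) x)
  refine ⟨fun w => ∑ i, (EuclideanSpace.proj i : EuclideanSpace ℝ (Fin d) →L[ℝ] ℝ).smulRight
    (chartDeriv m x w (s i w)), ?_, ?_, ?_, ?_⟩
  · have hxs : x ∈ (chartAt (EuclideanSpace ℝ (Fin m)) x).source := mem_chart_source _ x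
    refine tendsto_finsetSum _ fun i _ => ?_
    have hi := (FiberBundle.continuousWithinAt_totalSpace (EuclideanSpace ℝ (Fin m)) _).1
      ((hs i).continuousWithinAt ⟨hx, mem_of_mem_nhds hW⟩)
    have h2 : Tendsto (fun w => chartDeriv m x w (s i w)) (𝓝[Λ] x)
        (𝓝 (chartDeriv m x x (s i x))) := by
      have h3 := hi.2.tendsto
      rw [nhdsWithin_inter_of_mem' (nhdsWithin_le_nhds hW)] at h3
      rw [← trivializationAt_tangentBundle_snd hxs]
      refine h3.congr' ?_
      filter_upwards [nhdsWithin_le_nhds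
        ((chartAt (EuclideanSpace ℝ (Fin m)) x).open_source.mem_nhds hxs)] with w hw
      exact trivializationAt_tangentBundle_snd hw _
    exact ((ContinuousLinearMap.smulRightL ℝ (EuclideanSpace ℝ (Fin d))
      (EuclideanSpace ℝ (Fin m)) (EuclideanSpace.proj i)).continuous.tendsto _).comp h2
  · rw [injective_iff_map_eq_zero]
    intro b hb
    have h0 : chartDeriv m x x (∑ i, b i • s i x) = 0 := by simpa using hb
    have h1 := (injective_iff_map_eq_zero _).1 hinj _ h0
    ext i
    exact Fintype.linearIndependent_iff.1 hli (fun i => b i) h1 i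
  · rw [← hsp, Submodule.map_span]
    apply le_antisymm
    · rintro _ ⟨b, rfl⟩
      simp only [ContinuousLinearMap.coe_coe, _root_.sum_apply,
        ContinuousLinearMap.smulRight_apply]
      exact sum_mem fun i _ => Submodule.smul_mem _ _ (Submodule.subset_span ⟨_, ⟨i, rfl⟩, rfl⟩)
    · rw [Submodule.span_le]
      rintro _ ⟨_, ⟨i, rfl⟩, rfl⟩
      refine ⟨EuclideanSpace.single i 1, ?_⟩
      simp
  · filter_upwards [self_mem_nhdsWithin, nhdsWithin_le_nhds hW] with w hwΛ hwW b
    refine ⟨∑ i, b i • s i w, ?_, ?_⟩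
    · rw [← (hspan w ⟨hwΛ, hwW⟩).2]
      exact sum_mem fun i _ => Submodule.smul_mem _ _ (Submodule.subset_span ⟨i, rfl⟩)
    · simp

end Frames

/-! ### Sliding points along plaques -/

section Slide

variable {m : ℕ} {M : Type u} [TopologicalSpace M] [ChartedSpace (EuclideanSpace ℝ (Fin m)) M]
  [IsManifold (𝓡 m) 1 M] {d : ℕ}

/-- Points of `Λ` near a point `x` where plaques are contained in fibres can be moved inside their
fibre into the affine subspace transverse to the plaques through a nearby point. -/
theorem Lamination.eventually_exists_slide (L : Lamination m M d) {U Q Λ : Set M} {Γ : Type*}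
    {h : Λ → Γ} (hΛ : Λ ⊆ L.support)
    (hfib : ∀ x : Λ, relFrontier L.leafTopology (L.localLeaf U x) (fibre h (h x)) ⊆ Q)
    {E : ∀ x : M, Submodule ℝ (TangentSpace (𝓡 m) x)} (hT : L.IsTangentOn Λ E) {x : M}
    (hx : x ∈ Λ) (hU : U ∈ 𝓝 x) (hQ : Qᶜ ∈ 𝓝 x)
    {S : M → EuclideanSpace ℝ (Fin d) →L[ℝ] EuclideanSpace ℝ (Fin m)}
    (hS : Tendsto S (𝓝[Λ] x) (𝓝 (S x)))
    (hSE : ∀ᶠ w in 𝓝[Λ] x, ∀ b, ∃ ζ ∈ E w, chartDeriv m x w ζ = S w b)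
    {P : EuclideanSpace ℝ (Fin m) →L[ℝ] EuclideanSpace ℝ (Fin d)} (hP : ∀ v, P (S x v) = v)
    {ε : ℝ} (hε : 0 < ε) :
    ∀ᶠ p : M × M in 𝓝 (x, x), ∀ hp : p.2 ∈ Λ, ∃ z : Λ, h z = h ⟨p.2, hp⟩ ∧
      (z : M) ∈ (extChartAt (𝓡 m) x).source ∧
      P (extChartAt (𝓡 m) x z - extChartAt (𝓡 m) x p.1) = 0 ∧
      ‖(ContinuousLinearMap.id ℝ (EuclideanSpace ℝ (Fin m)) - S x ∘L P)
        (extChartAt (𝓡 m) x z - extChartAt (𝓡 m) x p.2)‖ ≤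
        ε * ‖P (extChartAt (𝓡 m) x p.2 - extChartAt (𝓡 m) x p.1)‖ := by
  set ψ := extChartAt (𝓡 m) x with hψ
  set q := ContinuousLinearMap.id ℝ (EuclideanSpace ℝ (Fin m)) - S x ∘L P with hq
  obtain ⟨φ, hφ, s₀, v₀, hφx⟩ := L.cover x (hΛ hx)
  have hemb := φ.isEmbedding
  set Φ : φ.T × EuclideanSpace ℝ (Fin d) → M := fun p => φ.toFun p.1 p.2 with hΦ
  have hΦc : Continuous Φ := hemb.continuous
  have hcone : ∀ᶠ w in 𝓝 x, w ∈ Λ → ∀ a, ∃ ζ ∈ E w, P (chartDeriv m x w ζ) = a ∧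
      ‖q (chartDeriv m x w ζ)‖ ≤ ε / 2 * ‖a‖ := by
    have := eventually_cone_of_tendsto hS hP (half_pos hε)
    filter_upwards [eventually_nhdsWithin_iff.1 (this.and hSE)] with w hw hwΛ a
    obtain ⟨h1, h2⟩ := hw hwΛ
    obtain ⟨b, hb, hb'⟩ := h1 a
    obtain ⟨ζ, hζ, hζb⟩ := h2 b
    refine ⟨ζ, hζ, by rw [hζb, hb], ?_⟩
    rw [hζb]
    simpa [hq, hb] using hb'
  have hgood : ∀ᶠ p in 𝓝 (s₀, v₀), Φ p ∈ U ∧ Φ p ∉ Q ∧ Φ p ∈ ψ.source ∧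
      (Φ p ∈ Λ → ∀ a, ∃ ζ ∈ E (Φ p), P (chartDeriv m x (Φ p) ζ) = a ∧
      ‖q (chartDeriv m x (Φ p) ζ)‖ ≤ ε / 2 * ‖a‖) := by
    have hlim : Tendsto Φ (𝓝 (s₀, v₀)) (𝓝 x) := by
      have := hΦc.tendsto (s₀, v₀)
      rwa [show Φ (s₀, v₀) = x from hφx] at this
    exact hlim.eventually (Filter.eventually_and.2 ⟨hU, Filter.eventually_and.2 ⟨hQ,
      Filter.eventually_and.2 ⟨extChartAt_source_mem_nhds x, hcone⟩⟩⟩)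
  rw [nhds_prod_eq] at hgood
  obtain ⟨pT, hpT, pV, hpV, hgood⟩ := eventually_prod_iff.1 hgood
  obtain ⟨r, hr0, hr⟩ := Metric.nhds_basis_closedBall.eventually_iff.1 hpV
  -- The boundary condition of `exists_mem_fiber_of_cone`, with `κ = ε⁻¹`. At `(s₀, x, x)` the left
  -- side is zero, while the right side is positive because box and chart are injective. Compactness
  -- of the sphere propagates this to nearby parameters.
  have hbdry : ∀ᶠ τ : φ.T × M × M in 𝓝 (s₀, x, x), ∀ v ∈ Metric.sphere v₀ r,
      ‖P (ψ τ.2.2 - ψ τ.2.1)‖ <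
        ‖P (ψ (Φ (τ.1, v)) - ψ τ.2.1)‖ + ε⁻¹ * ‖q (ψ (Φ (τ.1, v)) - ψ τ.2.2)‖ := by
    refine (isCompact_sphere v₀ r).eventually_forall_of_forall_eventually fun v hv => ?_
    have hvs : Φ (s₀, v) ∈ ψ.source := by
      have hpTs₀ : pT s₀ := hpT.self_of_nhds
      exact (hgood hpTs₀ (hr (Metric.sphere_subset_closedBall hv))).2.2.1
    have hne : ψ (Φ (s₀, v)) - ψ x ≠ 0 := fun h0 => by
      have h1 : Φ (s₀, v) = Φ (s₀, v₀) := by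
        rw [show Φ (s₀, v₀) = x from hφx]
        exact ψ.injOn hvs (mem_extChartAt_source x) (sub_eq_zero.1 h0)
      have h2 : v = v₀ := congrArg Prod.snd (hemb.injective h1)
      rw [h2, mem_sphere_iff_norm, sub_self, norm_zero] at hv
      exact hr0.ne hv
    have hpos : 0 < ‖P (ψ (Φ (s₀, v)) - ψ x)‖ + ε⁻¹ * ‖q (ψ (Φ (s₀, v)) - ψ x)‖ := by
      by_cases hPz : P (ψ (Φ (s₀, v)) - ψ x) = 0
      · have : q (ψ (Φ (s₀, v)) - ψ x) = ψ (Φ (s₀, v)) - ψ x := by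
          rw [hq, _root_.sub_apply, ContinuousLinearMap.comp_apply, hPz]
          simp
        rw [this]
        have := norm_pos_iff.2 hne
        positivity
      · have := norm_pos_iff.2 hPz
        positivity
    have c1 : ContinuousAt (fun p : (φ.T × M × M) × EuclideanSpace ℝ (Fin d) => ψ p.1.2.1)
        ((s₀, x, x), v) :=
      (continuousAt_extChartAt (I := 𝓡 m) x).comp (f := fun p :
        (φ.T × M × M) × EuclideanSpace ℝ (Fin d) => p.1.2.1) (by fun_prop)
    have c2 : ContinuousAt (fun p : (φ.T × M × M) × EuclideanSpace ℝ (Fin d) => ψ p.1.2.2)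
        ((s₀, x, x), v) :=
      (continuousAt_extChartAt (I := 𝓡 m) x).comp (f := fun p :
        (φ.T × M × M) × EuclideanSpace ℝ (Fin d) => p.1.2.2) (by fun_prop)
    have c3 : ContinuousAt (fun p : (φ.T × M × M) × EuclideanSpace ℝ (Fin d) =>
        ψ (Φ (p.1.1, p.2))) ((s₀, x, x), v) :=
      (continuousAt_extChartAt' (I := 𝓡 m) hvs).comp (f := fun p :
        (φ.T × M × M) × EuclideanSpace ℝ (Fin d) => Φ (p.1.1, p.2)) (by fun_prop)
    refine ContinuousAt.eventually_lt (P.continuous.continuousAt.comp (c2.sub c1)).norm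
      ((P.continuous.continuousAt.comp (c3.sub c1)).norm.add
        (continuousAt_const.mul (q.continuous.continuousAt.comp (c3.sub c2)).norm)) ?_
    simpa using hpos
  rw [nhds_prod_eq] at hbdry
  obtain ⟨qT, hqT, qM, hqM, hbdry⟩ := eventually_prod_iff.1 hbdry
  have hbox : ∀ᶠ z in 𝓝 x, z ∈ L.support → ∃ s v, Φ (s, v) = z ∧ pT s ∧ qT s ∧
      v ∈ Metric.ball v₀ r := by
    obtain ⟨W, hW, hrange⟩ := φ.range_eq
    have hxW : x ∈ W := by
      have : x ∈ L.support ∩ W := by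
        rw [← hrange]
        exact ⟨(s₀, v₀), hφx⟩
      exact this.2
    have hn : ∀ᶠ p in 𝓝 (s₀, v₀), pT p.1 ∧ qT p.1 ∧ p.2 ∈ Metric.ball v₀ r := by
      rw [nhds_prod_eq]
      have := (hpT.and hqT).prod_mk (Metric.ball_mem_nhds v₀ hr0 : ∀ᶠ v in 𝓝 v₀, _)
      filter_upwards [this] with p hp using ⟨hp.1.1, hp.1.2, hp.2⟩
    rw [hemb.isInducing.nhds_eq_comap, eventually_comap] at hn
    have hx' : Φ (s₀, v₀) = x := hφx
    change ∀ᶠ b in 𝓝 (Φ (s₀, v₀)), _ at hn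
    rw [hx'] at hn
    filter_upwards [hn, hW.mem_nhds hxW] with z hz hzW hzL
    have : z ∈ range fun p : φ.T × EuclideanSpace ℝ (Fin d) => φ.toFun p.1 p.2 := by
      rw [hrange]
      exact ⟨hzL, hzW⟩
    obtain ⟨⟨s, v⟩, hsv⟩ := this
    exact ⟨s, v, hsv, hz _ hsv⟩
  have hsnd : Tendsto (Prod.snd : M × M → M) (𝓝 (x, x)) (𝓝 x) := continuous_snd.tendsto (x, x)
  filter_upwards [hsnd.eventually hbox, hqM] with p hp hqp hpΛ
  obtain ⟨s, v', hsv, hpTs, hqTs, hv'⟩ := hp (hΛ hpΛ)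
  have hmem : ∀ v ∈ Metric.closedBall v₀ r, _ := fun v hv => hgood hpTs (hr hv)
  -- The whole disc lies in a fibre, hence in `Λ`, where its tangent spaces are known to be `E`;
  -- without this the cone condition would be available only at isolated points.
  have hfibre : ∀ v ∈ Metric.closedBall v₀ r, Φ (s, v) ∈ fibre h (h ⟨p.2, hpΛ⟩) := by
    intro v hv
    have hΛ' : φ.toFun s v' ∈ Λ := by rw [show φ.toFun s v' = p.2 from hsv]; exact hpΛ
    have := L.plaque_subset_fibre hfib hφ (s := s) (convex_closedBall v₀ r).isPreconnected
      (fun v hv => (hmem v hv).1) (fun v hv => (hmem v hv).2.1)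
      (Metric.ball_subset_closedBall hv') hv hΛ'
    convert this using 3
    exact Subtype.ext hsv.symm
  have hbdry' := hbdry hqTs hqp
  dsimp only at hbdry'
  rw [← hsv] at hbdry'
  have hderiv : ∀ v ∈ Metric.ball v₀ r,
      ∃ J : EuclideanSpace ℝ (Fin d) →L[ℝ] EuclideanSpace ℝ (Fin m),
      HasFDerivAt (fun v => ψ (Φ (s, v))) J v ∧
      ∀ a, ∃ ξ, P (J ξ) = a ∧ ‖q (J ξ)‖ ≤ ε / 2 * ‖a‖ := by
    intro v hv
    replace hv := Metric.ball_subset_closedBall hv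
    obtain ⟨-, -, hsrc, hcone⟩ := hmem v hv
    have hder : HasMFDerivAt (𝓡 d) 𝓘(ℝ, EuclideanSpace ℝ (Fin m)) (fun v => ψ (Φ (s, v))) v
        ((mfderiv (𝓡 m) 𝓘(ℝ, EuclideanSpace ℝ (Fin m)) ψ (Φ (s, v))).comp
          (mfderiv (𝓡 d) (𝓡 m) (φ.toFun s) v)) :=
      HasMFDerivAt.comp v (mdifferentiableAt_extChartAt (by rwa [← extChartAt_source (𝓡 m)])).hasMFDerivAt
        ((φ.contMDiff s).mdifferentiable one_ne_zero v).hasMFDerivAt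
    refine ⟨_, hasMFDerivAt_iff_hasFDerivAt.1 hder, fun a => ?_⟩
    obtain ⟨hz, -⟩ := mem_fibre_iff.1 (hfibre v hv)
    obtain ⟨ζ, hζ, ha⟩ := hcone hz a
    rw [← hT φ hφ s v hz] at hζ
    obtain ⟨ξ, rfl⟩ := hζ
    exact ⟨ξ, ha⟩
  have hcont : ContinuousOn (fun v => ψ (Φ (s, v))) (Metric.closedBall v₀ r) := fun v hv =>
    ((continuousAt_extChartAt' (I := 𝓡 m) (hmem v hv).2.2.1).comp (f := fun v => Φ (s, v))
      (by fun_prop)).continuousWithinAt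
  -- The cones have width `ε / 2`, so `κ` times the width is `1 / 2 < 1`.
  obtain ⟨v, hv, h1, h2⟩ := exists_mem_fiber_of_cone (inv_nonneg.2 hε.le)
    (by rw [← mul_div_assoc, inv_mul_cancel₀ hε.ne']; norm_num) hcont hderiv hv' hbdry'
  obtain ⟨hz, hhz⟩ := mem_fibre_iff.1 (hfibre v (Metric.ball_subset_closedBall hv))
  refine ⟨⟨_, hz⟩, hhz, (hmem v (Metric.ball_subset_closedBall hv)).2.2.1, h1, ?_⟩
  rwa [inv_mul_le_iff₀ hε, hsv] at h2

end Slide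

/-! ### Halving the distance after a slide -/

section Contraction

/-- Sliding the second point along `S` onto the kernel of `P` and applying a map whose derivative
is small on this kernel brings two points closer. -/
theorem exists_eventually_norm_sub_le_half {E W H H' : Type*} [NormedAddCommGroup E]
    [NormedSpace ℝ E] [NormedAddCommGroup W] [NormedSpace ℝ W] [NormedAddCommGroup H]
    [NormedSpace ℝ H] [NormedAddCommGroup H'] [NormedSpace ℝ H'] {e : E → H} {G : E → H'}
    {y₀ : E} {e' : E →L[ℝ] H} {G' : E →L[ℝ] H'} (he : HasStrictFDerivAt e e' y₀)
    (hG : HasStrictFDerivAt G G' y₀) {P : E →L[ℝ] W} {S : W →L[ℝ] E} {c : ℝ} (hc : 0 < c)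
    (hec : ∀ v, c * ‖v‖ ≤ ‖e' v‖)
    (hGP : ∀ v, ‖G' ((ContinuousLinearMap.id ℝ E - S ∘L P) v)‖ ≤ 1 / 4 * ‖e' v‖) :
    ∃ ε > 0, ∀ᶠ p : E × E in 𝓝 (y₀, y₀), ∀ y, P (y - p.1) = 0 →
      ‖(ContinuousLinearMap.id ℝ E - S ∘L P) (y - p.2)‖ ≤ ε * ‖P (p.2 - p.1)‖ →
      ‖G y - G p.1‖ ≤ ‖e p.2 - e p.1‖ / 2 := by
  set q := ContinuousLinearMap.id ℝ E - S ∘L P with hq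
  set K := ‖q‖ + ‖P‖ with hK
  -- Of the final factor `1 / 2`, one quarter comes from `hGP`. The rest absorbs the linearisation
  -- errors, governed by `δ * (K + 1) = c / 8`, and the slide, governed by `ε * ‖G'‖ * ‖P‖ ≤ c / 8`.
  set δ := c / (8 * (K + 1)) with hδ
  set ε := min 1 (c / (8 * (‖G'‖ * ‖P‖ + 1))) with hε
  have hK0 : 0 ≤ K := by positivity
  have hδ0 : 0 < δ := by positivity
  have hε0 : 0 < ε := by positivity
  refine ⟨ε, hε0, ?_⟩
  obtain ⟨η, hη, hGη⟩ := Metric.eventually_nhds_iff.1 (hG.isLittleO.def hδ0)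
  have hlim : Tendsto (fun p : E × E => ‖p.1 - y₀‖ + K * ‖p.2 - p.1‖) (𝓝 (y₀, y₀)) (𝓝 0) := by
    have : Continuous fun p : E × E => ‖p.1 - y₀‖ + K * ‖p.2 - p.1‖ := by fun_prop
    simpa using this.tendsto (y₀, y₀)
  have heδ : ∀ᶠ p : E × E in 𝓝 (y₀, y₀), ‖e p.2 - e p.1 - e' (p.2 - p.1)‖ ≤ δ * ‖p.2 - p.1‖ :=
    (continuous_swap.tendsto (y₀, y₀)).eventually (he.isLittleO.def hδ0)
  filter_upwards [hlim.eventually_lt_const hη, heδ] with p hp hep y hPy hqy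
  -- Since `P (y - p.1) = 0`, the displacement is fixed by `q`: it splits into the small effect of
  -- the slide and a part on which `G'` contracts.
  have hqP : y - p.1 = q (y - p.2) + q (p.2 - p.1) := by
    rw [← map_add, sub_add_sub_cancel, hq, _root_.sub_apply, ContinuousLinearMap.comp_apply, hPy]
    simp
  set n := ‖p.2 - p.1‖
  have hn0 : 0 ≤ n := norm_nonneg _
  have hPn : ‖P (p.2 - p.1)‖ ≤ ‖P‖ * n := P.le_opNorm _
  have hqy' : ‖q (y - p.2)‖ ≤ ε * (‖P‖ * n) := hqy.trans (by gcongr)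
  have hyp : ‖y - p.1‖ ≤ K * n := by
    rw [hqP]
    refine (norm_add_le _ _).trans ?_
    have h1 := q.le_opNorm (p.2 - p.1)
    have h2 : ε * (‖P‖ * n) ≤ 1 * (‖P‖ * n) := by gcongr; exact min_le_left _ _
    rw [hK]
    linarith
  have hGy : ‖G y - G p.1 - G' (y - p.1)‖ ≤ δ * ‖y - p.1‖ := by
    refine hGη (y := (y, p.1)) ?_
    rw [Prod.dist_eq, max_lt_iff, dist_eq_norm, dist_eq_norm]
    have := norm_add_le (y - p.1) (p.1 - y₀)
    rw [sub_add_sub_cancel] at this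
    exact ⟨by dsimp only; linarith, by dsimp only; linarith [mul_nonneg hK0 hn0]⟩
  have h1 : ‖G' (y - p.1)‖ ≤ ‖G'‖ * (ε * (‖P‖ * n)) + 1 / 4 * ‖e' (p.2 - p.1)‖ := by
    rw [hqP, map_add]
    exact (norm_add_le _ _).trans (add_le_add ((G'.le_opNorm _).trans (by gcongr)) (hGP _))
  have h2 : ‖G y - G p.1‖ ≤ δ * (K * n) + ‖G' (y - p.1)‖ := by
    have := norm_add_le (G y - G p.1 - G' (y - p.1)) (G' (y - p.1))
    rw [sub_add_cancel] at this
    have h3 : δ * ‖y - p.1‖ ≤ δ * (K * n) := by gcongr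
    linarith
  have h3 : ‖e' (p.2 - p.1)‖ ≤ ‖e p.2 - e p.1‖ + δ * n := by
    have := norm_sub_le (e p.2 - e p.1) (e p.2 - e p.1 - e' (p.2 - p.1))
    rw [sub_sub_cancel] at this
    linarith
  have h4 : c * n ≤ ‖e' (p.2 - p.1)‖ := hec _
  have h5 : δ * (K + 1) = c / 8 := by rw [hδ]; field_simp
  have h6 : ε * (‖G'‖ * ‖P‖ + 1) ≤ c / 8 := by
    refine (mul_le_mul_of_nonneg_right (min_le_right _ _) (by positivity)).trans (le_of_eq ?_)
    field_simp
  have h7 := mul_le_mul_of_nonneg_right h6 hn0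
  have h8 : δ * (K + 1) * n = c / 8 * n := by rw [h5]
  nlinarith [mul_nonneg hε0.le hn0, mul_nonneg hδ0.le hn0]

end Contraction

/-! ### Backward contraction of the unstable bundle -/

section Expansion

variable {m : ℕ} {M : Type u} [TopologicalSpace M] [ChartedSpace (EuclideanSpace ℝ (Fin m)) M]

theorem mfderiv_iterate_succ {f : M → M} (hf : ContMDiff (𝓡 m) (𝓡 m) 1 f) (k : ℕ) (x : M)
    (v : TangentSpace (𝓡 m) x) :
    mfderiv (𝓡 m) (𝓡 m) f^[k + 1] x v =
      mfderiv (𝓡 m) (𝓡 m) f^[k] (f x) (mfderiv (𝓡 m) (𝓡 m) f x v) := by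
  have := mfderiv_comp x ((hf.iterate k).mdifferentiable one_ne_zero (f x))
    (hf.mdifferentiable one_ne_zero x)
  rw [Function.iterate_succ, this]
  rfl

theorem mfderiv_iterate_mem {f : M → M} (hf : ContMDiff (𝓡 m) (𝓡 m) 1 f) {Λ : Set M}
    {E : ∀ x : M, Submodule ℝ (TangentSpace (𝓡 m) x)}
    (hinv : ∀ x ∈ Λ, ∀ v ∈ E x, mfderiv (𝓡 m) (𝓡 m) f x v ∈ E (f x)) (hΛ : MapsTo f Λ Λ)
    (n : ℕ) {x : M} (hx : x ∈ Λ) {v : TangentSpace (𝓡 m) x} (hv : v ∈ E x) :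
    mfderiv (𝓡 m) (𝓡 m) f^[n] x v ∈ E (f^[n] x) := by
  induction n generalizing x with
  | zero =>
    rw [Function.iterate_zero, mfderiv_id]
    exact hv
  | succ n ih =>
    rw [mfderiv_iterate_succ hf]
    exact ih (hΛ hx) (hinv x hx v hv)

theorem mfderiv_apply_of_leftInverse {F F' : M → M} (hF : MDifferentiable (𝓡 m) (𝓡 m) F)
    (hF' : MDifferentiable (𝓡 m) (𝓡 m) F') (hleft : Function.LeftInverse F' F) (x : M)
    (v : TangentSpace (𝓡 m) x) :
    mfderiv (𝓡 m) (𝓡 m) F' (F x) (mfderiv (𝓡 m) (𝓡 m) F x v) = v := by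
  have h1 := mfderiv_comp x (hF' (F x)) (hF x)
  rw [hleft.comp_eq_id, mfderiv_id] at h1
  exact (congrArg (fun T : TangentSpace (𝓡 m) x →L[ℝ] TangentSpace (𝓡 m) x => T v) h1).symm

theorem Diffeomorph.leftInverse_iterate_symm (f : M ≃ₘ^1⟮𝓡 m, 𝓡 m⟯ M) (n : ℕ) :
    Function.LeftInverse f.symm^[n] f^[n] :=
  Function.LeftInverse.iterate f.symm_apply_apply n

variable [IsManifold (𝓡 m) 1 M]

theorem IsSubbundleOn.finrank_eq {d : ℕ} {Λ : Set M}
    {E : ∀ x : M, Submodule ℝ (TangentSpace (𝓡 m) x)} (hE : IsSubbundleOn Λ d E) {x : M}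
    (hx : x ∈ Λ) : Module.finrank ℝ (E x) = d := by
  obtain ⟨W, hW, s, -, hs⟩ := hE x hx
  obtain ⟨hli, hsp⟩ := hs x ⟨hx, mem_of_mem_nhds hW⟩
  rw [← hsp, finrank_span_eq_card hli, Fintype.card_fin]

/-- Invariant subbundles are mapped onto themselves by the derivative of a diffeomorphism. -/
theorem exists_mem_mfderiv_iterate_eq (f : M ≃ₘ^1⟮𝓡 m, 𝓡 m⟯ M) {Λ : Set M} {d : ℕ}
    {E : ∀ x : M, Submodule ℝ (TangentSpace (𝓡 m) x)} (hE : IsSubbundleOn Λ d E)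
    (hinv : ∀ x ∈ Λ, ∀ v ∈ E x, mfderiv (𝓡 m) (𝓡 m) f x v ∈ E (f x)) (hΛ : MapsTo f Λ Λ)
    (n : ℕ) {x : M} (hx : x ∈ Λ) {u : TangentSpace (𝓡 m) (f^[n] x)} (hu : u ∈ E (f^[n] x)) :
    ∃ v ∈ E x, mfderiv (𝓡 m) (𝓡 m) f^[n] x v = u := by
  set T : EuclideanSpace ℝ (Fin m) →ₗ[ℝ] EuclideanSpace ℝ (Fin m) :=
    (mfderiv (𝓡 m) (𝓡 m) f^[n] x).toLinearMap
  have hT : Function.Injective T := Function.LeftInverse.injective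
    (mfderiv_apply_of_leftInverse ((f.contMDiff.iterate n).mdifferentiable one_ne_zero)
      ((f.symm.contMDiff.iterate n).mdifferentiable one_ne_zero)
      (f.leftInverse_iterate_symm n) x)
  let A : Submodule ℝ (EuclideanSpace ℝ (Fin m)) := E x
  let B : Submodule ℝ (EuclideanSpace ℝ (Fin m)) := E (f^[n] x)
  have hle : A.map T ≤ B := by
    rintro _ ⟨v, hv, rfl⟩
    exact mfderiv_iterate_mem f.contMDiff hinv hΛ n hx hv
  have heq : A.map T = B := by
    -- Invariance is only an inclusion; injectivity of the derivative and constancy of the rank make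
    -- it an equality.
    refine Submodule.eq_of_le_of_finrank_eq hle ?_
    rw [← (Submodule.equivMapOfInjective T hT A).finrank_eq]
    exact (hE.finrank_eq hx).trans (hE.finrank_eq (hΛ.iterate n hx)).symm
  have huB : u ∈ A.map T := by
    rw [heq]
    exact hu
  obtain ⟨v, hv, hvu⟩ := huB
  exact ⟨v, hv, hvu⟩

variable [RiemannianBundle (fun x : M => TangentSpace (𝓡 m) x)]

/-- Backward iterates contract an expanding subbundle. -/
theorem exists_norm_mfderiv_iterate_symm_le (f : M ≃ₘ^1⟮𝓡 m, 𝓡 m⟯ M) {Λ : Set M} {d : ℕ}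
    {E : ∀ x : M, Submodule ℝ (TangentSpace (𝓡 m) x)} (hE : IsSubbundleOn Λ d E)
    (hinv : ∀ x ∈ Λ, ∀ v ∈ E x, mfderiv (𝓡 m) (𝓡 m) f x v ∈ E (f x)) (hΛ : MapsTo f Λ Λ)
    (hΛ' : MapsTo f.symm Λ Λ)
    (hexp : ∃ N : ℕ, 0 < N ∧ ∀ x ∈ Λ, ∀ v ∈ E x, ‖v‖ = 1 →
      2 < ‖mfderiv (𝓡 m) (𝓡 m) (f^[N]) x v‖) :
    ∃ N : ℕ, 0 < N ∧ ∀ k : ℕ, ∀ x ∈ Λ, ∀ u ∈ E x,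
      ‖mfderiv (𝓡 m) (𝓡 m) (f.symm^[N])^[k] x u‖ ≤ (1 / 2) ^ k * ‖u‖ := by
  obtain ⟨N, hN, hexp⟩ := hexp
  refine ⟨N, hN, fun k => ?_⟩
  have hF := f.contMDiff.iterate N
  have hF' := f.symm.contMDiff.iterate N
  have hstep : ∀ x ∈ Λ, ∀ u ∈ E x, mfderiv (𝓡 m) (𝓡 m) f.symm^[N] x u ∈ E (f.symm^[N] x) ∧
      ‖mfderiv (𝓡 m) (𝓡 m) f.symm^[N] x u‖ ≤ 1 / 2 * ‖u‖ := by
    intro x hx u hu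
    obtain ⟨x₁, hx₁, rfl⟩ : ∃ x₁ ∈ Λ, f^[N] x₁ = x :=
      ⟨f.symm^[N] x, hΛ'.iterate N hx, Function.LeftInverse.iterate f.apply_symm_apply N x⟩
    obtain ⟨v, hv, rfl⟩ := exists_mem_mfderiv_iterate_eq f hE hinv hΛ N hx₁ hu
    have hleft := f.leftInverse_iterate_symm N
    have hd := mfderiv_apply_of_leftInverse (hF.mdifferentiable one_ne_zero)
      (hF'.mdifferentiable one_ne_zero) hleft x₁ v
    have hle : ‖v‖ ≤ 1 / 2 * ‖mfderiv (𝓡 m) (𝓡 m) f^[N] x₁ v‖ := by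
      by_cases hv0 : ‖v‖ = 0
      · rw [hv0]
        positivity
      · have h1 := hexp x₁ hx₁ (‖v‖⁻¹ • v) (Submodule.smul_mem _ _ hv) (by
          rw [norm_smul, norm_inv, norm_norm, inv_mul_cancel₀ hv0])
        have hpos : 0 < ‖v‖ := lt_of_le_of_ne (norm_nonneg _) (Ne.symm hv0)
        rw [map_smul, norm_smul, norm_inv, norm_norm, lt_inv_mul_iff₀ hpos] at h1
        linarith
    -- The vectors agree in the model space, but the Riemannian norm depends on the base point, so
    -- the equality of base points has to be substituted with `y` a variable.
    have key : ∀ y, y = x₁ → ∀ w : TangentSpace (𝓡 m) y, @Eq (EuclideanSpace ℝ (Fin m)) w v →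
        w ∈ E y ∧ ‖w‖ ≤ 1 / 2 * ‖mfderiv (𝓡 m) (𝓡 m) f^[N] x₁ v‖ := by
      rintro _ rfl w hw
      have hw : w = v := hw
      rw [hw]
      exact ⟨hv, hle⟩
    exact key _ (hleft x₁) _ hd
  induction k with
  | zero =>
    intro x _ u _
    rw [Function.iterate_zero, mfderiv_id, pow_zero, one_mul]
    exact le_rfl
  | succ k ih =>
    intro x hx u hu
    rw [mfderiv_iterate_succ hF']
    obtain ⟨h1, h2⟩ := hstep x hx u hu
    refine (ih _ (hΛ'.iterate N hx) _ h1).trans ?_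
    rw [pow_succ, mul_assoc]
    gcongr

end Expansion

/-! ### Contraction near a point of the class -/

section LocalContraction

variable {m : ℕ} {M : Type u} [TopologicalSpace M] [ChartedSpace (EuclideanSpace ℝ (Fin m)) M]
  [IsManifold (𝓡 m) 1 M] {H : Type*} [NormedAddCommGroup H] [NormedSpace ℝ H]

theorem ContMDiff.contDiffAt_comp_extChartAt_symm {G : M → H}
    (hG : ContMDiff (𝓡 m) 𝓘(ℝ, H) 1 G) {x w : M} (hw : w ∈ (extChartAt (𝓡 m) x).source) :
    ContDiffAt ℝ 1 (G ∘ (extChartAt (𝓡 m) x).symm) (extChartAt (𝓡 m) x w) := by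
  have h1 : ContMDiffOn 𝓘(ℝ, EuclideanSpace ℝ (Fin m)) 𝓘(ℝ, H) 1
      (G ∘ (extChartAt (𝓡 m) x).symm) (extChartAt (𝓡 m) x).target :=
    hG.comp_contMDiffOn (contMDiffOn_extChartAt_symm x)
  exact (contMDiffOn_iff_contDiffOn.1 h1).contDiffAt
    ((isOpen_extChartAt_target x).mem_nhds ((extChartAt (𝓡 m) x).map_source hw))

theorem ContMDiff.mfderiv_eq_fderiv_chartDeriv {G : M → H}
    (hG : ContMDiff (𝓡 m) 𝓘(ℝ, H) 1 G) {x w : M} (hw : w ∈ (extChartAt (𝓡 m) x).source)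
    (v : TangentSpace (𝓡 m) w) :
    mfderiv (𝓡 m) 𝓘(ℝ, H) G w v =
      fderiv ℝ (G ∘ (extChartAt (𝓡 m) x).symm) (extChartAt (𝓡 m) x w) (chartDeriv m x w v) := by
  have h1 : G =ᶠ[𝓝 w] (G ∘ (extChartAt (𝓡 m) x).symm) ∘ extChartAt (𝓡 m) x := by
    filter_upwards [(isOpen_extChartAt_source x).mem_nhds hw] with z hz
    rw [Function.comp_apply, Function.comp_apply, (extChartAt (𝓡 m) x).left_inv hz]
  have h2 := (hG.contDiffAt_comp_extChartAt_symm hw).differentiableAt one_ne_zero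
  rw [h1.mfderiv_eq, mfderiv_comp w h2.mdifferentiableAt
    (mdifferentiableAt_extChartAt (by rwa [← extChartAt_source (𝓡 m)])), mfderiv_eq_fderiv]
  rfl

variable [RiemannianBundle (fun x : M => TangentSpace (𝓡 m) x)]

/-- The distortion of the chart at `x` is bounded at `x`. -/
theorem exists_norm_le_chartDeriv (x : M) :
    ∃ C : ℝ, 0 ≤ C ∧ ∀ v : TangentSpace (𝓡 m) x, ‖v‖ ≤ C * ‖chartDeriv m x x v‖ := by
  obtain ⟨e, he⟩ := isInvertible_mfderiv_extChartAt (mem_extChartAt_source (I := 𝓡 m) x)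
  have : FiniteDimensional ℝ (TangentSpace (𝓡 m) x) :=
    inferInstanceAs (FiniteDimensional ℝ (EuclideanSpace ℝ (Fin m)))
  have hinj := chartDeriv_injective (mem_extChartAt_source (I := 𝓡 m) x)
  obtain ⟨K, hK, h⟩ := (chartDeriv m x x).toLinearMap.exists_antilipschitzWith
    (LinearMap.ker_eq_bot.2 hinj)
  exact ⟨K, K.2, fun v => by simpa using h.le_mul_dist v 0⟩

variable [IsContinuousRiemannianBundle (EuclideanSpace ℝ (Fin m)) (fun x : M => TangentSpace (𝓡 m) x)]

/-- Near each point the derivative factors through a chart: one factor is bounded because `G` is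
`C¹`, the other because the Riemannian metric is continuous. Compactness makes the bound global. -/
theorem ContMDiff.exists_norm_mfderiv_le [CompactSpace M] {G : M → H}
    (hG : ContMDiff (𝓡 m) 𝓘(ℝ, H) 1 G) :
    ∃ C : ℝ, 0 ≤ C ∧ ∀ w, ∀ v : TangentSpace (𝓡 m) w,
      @norm H _ (mfderiv (𝓡 m) 𝓘(ℝ, H) G w v) ≤ C * ‖v‖ := by
  suffices ∃ C : ℝ, 0 ≤ C ∧ ∀ w ∈ (univ : Set M), ∀ v : TangentSpace (𝓡 m) w,
      @norm H _ (mfderiv (𝓡 m) 𝓘(ℝ, H) G w v) ≤ C * ‖v‖ by simpa using this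
  refine isCompact_univ.induction_on ⟨0, le_rfl, by simp⟩ ?_ ?_ ?_
  · rintro s t hst ⟨C, hC, h⟩
    exact ⟨C, hC, fun w hw => h w (hst hw)⟩
  · rintro s t ⟨C, hC, h⟩ ⟨C', hC', h'⟩
    refine ⟨max C C', by positivity, ?_⟩
    rintro w (hw | hw) v
    · exact (h w hw v).trans (by gcongr; exact le_max_left _ _)
    · exact (h' w hw v).trans (by gcongr; exact le_max_right _ _)
  · intro x _
    obtain ⟨C, hC, hψ⟩ := eventually_norm_trivializationAt_lt (EuclideanSpace ℝ (Fin m))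
      (fun x : M => TangentSpace (𝓡 m) x) x
    set B := ‖fderiv ℝ (G ∘ (extChartAt (𝓡 m) x).symm) (extChartAt (𝓡 m) x x)‖ + 1
    have hB : ∀ᶠ w in 𝓝 x,
        ‖fderiv ℝ (G ∘ (extChartAt (𝓡 m) x).symm) (extChartAt (𝓡 m) x w)‖ < B := by
      have h1 := (hG.contDiffAt_comp_extChartAt_symm
        (mem_extChartAt_source (I := 𝓡 m) x)).continuousAt_fderiv one_ne_zero
      have h2 := (h1.comp (continuousAt_extChartAt (I := 𝓡 m) x)).norm
      exact h2.eventually_lt_const (lt_add_one _)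
    refine ⟨_, nhdsWithin_le_nhds (hψ.and (hB.and
      (extChartAt_source_mem_nhds (I := 𝓡 m) x))), B * C, by positivity, ?_⟩
    rintro w ⟨h1, h2, h3⟩ v
    rw [hG.mfderiv_eq_fderiv_chartDeriv h3]
    refine (ContinuousLinearMap.le_of_opNorm_le _ h2.le _).trans ?_
    rw [mul_assoc]
    gcongr
    have h4 := (ContinuousLinearMap.le_opNorm ((trivializationAt (EuclideanSpace ℝ (Fin m))
      (TangentSpace (𝓡 m)) x).continuousLinearMapAt ℝ w) v).trans
      (mul_le_mul_of_nonneg_right h1.le (norm_nonneg v))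
    rwa [TangentBundle.continuousLinearMapAt_trivializationAt
      (by rwa [← extChartAt_source (𝓡 m)])] at h4

/-- The iterate is chosen from the derivative at `x` alone, where it contracts `Eu x`; strict
differentiability carries the estimate to nearby pairs. It may depend on `x`. -/
theorem Lamination.eventually_exists_contraction [CompactSpace M] {dcs du : ℕ} (L : Lamination m M dcs)
    (f : M ≃ₘ^1⟮𝓡 m, 𝓡 m⟯ M) {U Q Λ : Set M} {Γ : Type*} {h : Λ → Γ} (hΛ : Λ ⊆ L.support)
    (hfib : ∀ x : Λ, relFrontier L.leafTopology (L.localLeaf U x) (fibre h (h x)) ⊆ Q)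
    {Ecs Eu : ∀ x : M, Submodule ℝ (TangentSpace (𝓡 m) x)}
    (hPH : IsPartiallyHyperbolic f Λ dcs du Ecs Eu) (hT : L.IsTangentOn Λ Ecs)
    (hfΛ : MapsTo f Λ Λ) (hfΛ' : MapsTo f.symm Λ Λ)
    {e : M → H} (he : ContMDiff (𝓡 m) 𝓘(ℝ, H) 1 e)
    (he' : ∀ x, Function.Injective (mfderiv (𝓡 m) 𝓘(ℝ, H) e x))
    {x : M} (hx : x ∈ Λ) (hU : U ∈ 𝓝 x) (hQ : Qᶜ ∈ 𝓝 x) :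
    ∃ n : ℕ, 0 < n ∧ ∀ᶠ p : M × M in 𝓝 (x, x), ∀ hp : p.2 ∈ Λ, ∃ z : Λ, h z = h ⟨p.2, hp⟩ ∧
      dist (e (f.symm^[n] p.1)) (e (f.symm^[n] z)) ≤ dist (e p.1) (e p.2) / 2 := by
  have hxs := mem_extChartAt_source (I := 𝓡 m) x
  set ψ := extChartAt (𝓡 m) x with hψ
  obtain ⟨S, hS, hSinj, hSrange, hSE⟩ := hPH.subbundle_cs.exists_frame hx
  -- the projection along `Eu`, in the chart
  let D : TangentSpace (𝓡 m) x ≃ₗ[ℝ] EuclideanSpace ℝ (Fin m) :=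
    LinearEquiv.ofBijective (chartDeriv m x x).toLinearMap
      ⟨chartDeriv_injective hxs, chartDeriv_surjective hxs⟩
  have hcompl : IsCompl (S x).toLinearMap.range ((Eu x).map (chartDeriv m x x).toLinearMap) := by
    rw [hSrange]
    exact (Submodule.orderIsoMapComap D).isCompl (hPH.splitting x hx)
  obtain ⟨P, hPS, hPker⟩ := exists_leftInverse_ker_eq hSinj hcompl
  -- choice of the iterate
  obtain ⟨N, hN, hcontr⟩ := exists_norm_mfderiv_iterate_symm_le f hPH.subbundle_u
    hPH.invariant_u hfΛ hfΛ' hPH.expands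
  obtain ⟨C₁, hC₁, hbound⟩ := he.exists_norm_mfderiv_le
  obtain ⟨C₂, hC₂, hchart⟩ := exists_norm_le_chartDeriv (m := m) x
  set e' := fderiv ℝ (e ∘ ψ.symm) (ψ x) with he'_def
  have he'inj : Function.Injective e' := by
    intro a b hab
    obtain ⟨a, rfl⟩ := chartDeriv_surjective hxs a
    obtain ⟨b, rfl⟩ := chartDeriv_surjective hxs b
    rw [he'_def, ← he.mfderiv_eq_fderiv_chartDeriv hxs, ← he.mfderiv_eq_fderiv_chartDeriv hxs] at hab
    rw [he' x hab]
  obtain ⟨K, hK, hKe⟩ := e'.toLinearMap.exists_antilipschitzWith (LinearMap.ker_eq_bot.2 he'inj)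
  have hKe' : ∀ v, ‖v‖ ≤ K * ‖e' v‖ := fun v => by simpa using hKe.le_mul_dist v 0
  set q := ContinuousLinearMap.id ℝ (EuclideanSpace ℝ (Fin m)) - S x ∘L P with hq
  -- The total distortion between lengths along `Eu` and lengths read by `e`; enough halvings beat
  -- it.
  set B := C₁ * (C₂ * (‖q‖ * K)) with hB
  have hB0 : 0 ≤ B := by positivity
  obtain ⟨k, hk⟩ := exists_pow_lt_of_lt_one (show (0 : ℝ) < 1 / (4 * (B + 1)) by positivity)
    (show (1 / 2 : ℝ) < 1 by norm_num)
  have hk' : (1 / 2 : ℝ) ^ (k + 1) * B ≤ 1 / 4 := by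
    rw [lt_div_iff₀ (by positivity)] at hk
    have : (0 : ℝ) < (1 / 2) ^ k := by positivity
    rw [pow_succ]
    nlinarith
  -- The exponent `k + 1` ensures that the number of iterates is positive.
  set F := (f.symm^[N])^[k + 1] with hF
  have hFn : F = f.symm^[N * (k + 1)] := by rw [hF, ← Function.iterate_mul]
  have hFd : ContMDiff (𝓡 m) (𝓡 m) 1 F := (f.symm.contMDiff.iterate N).iterate (k + 1)
  have hG : ContMDiff (𝓡 m) 𝓘(ℝ, H) 1 (e ∘ F) := he.comp hFd
  have hGP : ∀ v, ‖fderiv ℝ ((e ∘ F) ∘ ψ.symm) (ψ x) (q v)‖ ≤ 1 / 4 * ‖e' v‖ := by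
    intro v
    have hPq : P (q v) = 0 := by
      rw [hq, _root_.sub_apply, ContinuousLinearMap.comp_apply, map_sub, hPS]
      simp
    obtain ⟨u, hu, huv⟩ := (hPker _).1 hPq
    have huv : chartDeriv m x x u = q v := huv
    rw [← huv, ← hG.mfderiv_eq_fderiv_chartDeriv hxs, mfderiv_comp x
      (he.mdifferentiable one_ne_zero _) (hFd.mdifferentiable one_ne_zero x)]
    refine (hbound (F x) (mfderiv (𝓡 m) (𝓡 m) F x u)).trans ?_
    have h1 := hcontr (k + 1) x hx u hu
    have h2 : ‖u‖ ≤ C₂ * (‖q‖ * (K * ‖e' v‖)) := by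
      refine (hchart u).trans ?_
      rw [huv]
      gcongr
      exact (q.le_opNorm v).trans (by gcongr; exact hKe' v)
    calc C₁ * ‖mfderiv (𝓡 m) (𝓡 m) F x u‖
        ≤ C₁ * ((1 / 2) ^ (k + 1) * (C₂ * (‖q‖ * (K * ‖e' v‖)))) := by
          gcongr
          exact h1.trans (by gcongr)
      _ = ((1 / 2) ^ (k + 1) * B) * ‖e' v‖ := by rw [hB]; ring
      _ ≤ 1 / 4 * ‖e' v‖ := by gcongr
  obtain ⟨ε, hε, hev⟩ := exists_eventually_norm_sub_le_half
    ((he.contDiffAt_comp_extChartAt_symm hxs).hasStrictFDerivAt one_ne_zero)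
    ((hG.contDiffAt_comp_extChartAt_symm hxs).hasStrictFDerivAt one_ne_zero)
    (P := P) (S := S x) (c := (K : ℝ)⁻¹) (by positivity)
    (fun v => by rw [inv_mul_le_iff₀ (by exact_mod_cast hK)]; exact hKe' v) hGP
  have hψψ : Tendsto (fun p : M × M => (ψ p.1, ψ p.2)) (𝓝 (x, x)) (𝓝 (ψ x, ψ x)) :=
    ((continuousAt_extChartAt (I := 𝓡 m) x).comp (x := (x, x)) continuousAt_fst).prodMk
      ((continuousAt_extChartAt (I := 𝓡 m) x).comp (x := (x, x)) continuousAt_snd)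
  have hs₁ := (continuous_fst.tendsto (x, x)).eventually (extChartAt_source_mem_nhds (I := 𝓡 m) x)
  have hs₂ := (continuous_snd.tendsto (x, x)).eventually (extChartAt_source_mem_nhds (I := 𝓡 m) x)
  refine ⟨N * (k + 1), by positivity, ?_⟩
  filter_upwards [hψψ.eventually hev, hs₁, hs₂,
    L.eventually_exists_slide hΛ hfib hT hx hU hQ hS hSE hPS hε] with p hp hp₁ hp₂ hslide hpΛ
  obtain ⟨z, hz, hzs, hz₁, hz₂⟩ := hslide hpΛ
  refine ⟨z, hz, ?_⟩
  have := hp _ hz₁ hz₂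
  simp only [Function.comp_apply] at this
  rw [ψ.left_inv hp₁, ψ.left_inv hp₂, ψ.left_inv hzs, hFn] at this
  rw [dist_comm, dist_eq_norm, dist_comm, dist_eq_norm]
  exact this

end LocalContraction

/-! ### Uniformity over the class -/

section Uniform

theorem symm_map_mem_maximalInvariantSet {X : Type*} [TopologicalSpace X] (f : X ≃ₜ X) (U : Set X)
    {x : X} (hx : x ∈ maximalInvariantSet f U) : f.symm x ∈ maximalInvariantSet f U := by
  intro n
  have h := hx (n - 1)
  rw [zpow_sub_one] at h
  exact h

theorem IsFiltrating.isOpen {X : Type*} [TopologicalSpace X] {f : X → X} {U : Set X}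
    (hU : IsFiltrating f U) : IsOpen U := by
  obtain ⟨V₁, V₂, h₁, -, rfl, -⟩ := hU
  exact h₁.sdiff isClosed_closure

theorem IsChainRecurrenceClass.subset_maximalInvariantSet {X : Type*} [PseudoMetricSpace X]
    {f : X ≃ₜ X} {C U : Set X} (hC : IsChainRecurrenceClass f C) (hCU : C ⊆ U) :
    C ⊆ maximalInvariantSet f U :=
  fun _ hx n => hCU (hC.zpow_map_mem hx n)

/-- Uniform continuity with respect to the distance read through an embedding. -/
theorem Topology.IsEmbedding.exists_dist_lt_of_compact {Y H Γ : Type*} [TopologicalSpace Y]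
    [CompactSpace Y] [PseudoMetricSpace H] [PseudoMetricSpace Γ] {e : Y → H} (he : IsEmbedding e)
    {k : Y → Γ} (hk : Continuous k) {η : ℝ} (hη : 0 < η) :
    ∃ s > 0, ∀ z z', dist (e z) (e z') < s → dist (k z) (k z') < η := by
  have : CompactSpace (range e) := isCompact_iff_compactSpace.1 (isCompact_range he.continuous)
  obtain ⟨s, hs, h⟩ := Metric.uniformContinuous_iff.1
    (CompactSpace.uniformContinuous_of_continuous
      (hk.comp he.toHomeomorph.symm.continuous)) η hη
  refine ⟨s, hs, fun z z' hz => ?_⟩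
  have := h (a := he.toHomeomorph z) (b := he.toHomeomorph z') hz
  simpa only [Function.comp_apply, Homeomorph.symm_apply_apply] using this

/-- Uniform version over a compact set of a contraction valid near each of its points. -/
theorem IsCompact.exists_uniform_contraction {X H Γ : Type*} [TopologicalSpace X]
    [PseudoMetricSpace H] {e : X → H} (he : IsEmbedding e) {Λ R : Set X} (hR : IsCompact R)
    {F : X → X} {h : Λ → Γ}
    (hloc : ∀ x ∈ R, ∃ n : ℕ, 0 < n ∧ ∀ᶠ p : X × X in 𝓝 (x, x), ∀ hp : p.2 ∈ Λ,
      ∃ z : Λ, h z = h ⟨p.2, hp⟩ ∧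
      dist (e (F^[n] p.1)) (e (F^[n] z)) ≤ dist (e p.1) (e p.2) / 2) :
    ∃ K : ℕ, ∃ δ > 0, ∀ z ∈ R, ∀ z' : Λ, dist (e z) (e z') < δ →
      ∃ N, 0 < N ∧ N ≤ K ∧ ∃ z'' : Λ, h z'' = h z' ∧
        dist (e (F^[N] z)) (e (F^[N] z'')) ≤ dist (e z) (e z') / 2 := by
  refine hR.induction_on ⟨0, 1, one_pos, by simp⟩ ?_ ?_ ?_
  · rintro s t hst ⟨K, δ, hδ, H⟩
    exact ⟨K, δ, hδ, fun z hz => H z (hst hz)⟩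
  · rintro s t ⟨K, δ, hδ, H⟩ ⟨K', δ', hδ', H'⟩
    refine ⟨max K K', min δ δ', lt_min hδ hδ', ?_⟩
    rintro z (hz | hz) z' hzz'
    · obtain ⟨N, h0, hN, h1⟩ := H z hz z' (hzz'.trans_le (min_le_left _ _))
      exact ⟨N, h0, hN.trans (le_max_left _ _), h1⟩
    · obtain ⟨N, h0, hN, h1⟩ := H' z hz z' (hzz'.trans_le (min_le_right _ _))
      exact ⟨N, h0, hN.trans (le_max_right _ _), h1⟩
  · intro x hx
    obtain ⟨n, hn, hev⟩ := hloc x hx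
    -- Neighbourhoods of `(x, x)` are pulled back through `e`, so that closeness is measured by the
    -- distance that is halved.
    rw [nhds_prod_eq, he.isInducing.nhds_eq_comap, ← comap_prodMap_prod, ← nhds_prod_eq,
      eventually_comap] at hev
    obtain ⟨η, hη, hball⟩ := Metric.eventually_nhds_iff.1 hev
    refine ⟨e ⁻¹' Metric.ball (e x) (η / 2), mem_nhdsWithin_of_mem_nhds
      (he.continuous.continuousAt.preimage_mem_nhds (Metric.ball_mem_nhds _ (half_pos hη))),
      n, η / 2, half_pos hη, fun z hz z' hzz' => ⟨n, hn, le_rfl, ?_⟩⟩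
    have hz : dist (e z) (e x) < η / 2 := hz
    refine hball (y := (e z, e z')) ?_ (z, z') rfl z'.2
    rw [Prod.dist_eq, max_lt_iff]
    refine ⟨by dsimp only; linarith, ?_⟩
    have := dist_triangle_left (e (z' : X)) (e x) (e z)
    dsimp only
    linarith

end Uniform

/-! ### The main theorem -/

theorem mainTheorem3 {m : ℕ} {M : Type u} [MetricSpace M] [CompactSpace M]
    [ChartedSpace (EuclideanSpace ℝ (Fin m)) M] [IsManifold (𝓡 m) ∞ M]
    [RiemannianBundle (fun x : M => TangentSpace (𝓡 m) x)]
    [IsContinuousRiemannianBundle (EuclideanSpace ℝ (Fin m))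
      (fun x : M => TangentSpace (𝓡 m) x)]
    (f : M ≃ₘ^1⟮𝓡 m, 𝓡 m⟯ M) (U : Set M) (hU : IsFiltrating f U)
    (dcs du : ℕ) (Ecs Eu : ∀ x : M, Submodule ℝ (TangentSpace (𝓡 m) x))
    (hPH : IsPartiallyHyperbolic f (maximalInvariantSet f.toHomeomorph U) dcs du Ecs Eu)
    (Fcs : Lamination m M dcs)
    (hFcs : IsCenterStableLamination f (maximalInvariantSet f.toHomeomorph U) Ecs Fcs)
    {Γ : Type*} [MetricSpace Γ] [CompactSpace Γ] (g : Γ ≃ₜ Γ)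
    (h : maximalInvariantSet f.toHomeomorph U → Γ)
    (hcont : Continuous h) (hsurj : Function.Surjective h)
    (hsemi : ∀ x : maximalInvariantSet f.toHomeomorph U,
      g (h x) = h ⟨f x, map_mem_maximalInvariantSet f.toHomeomorph U x.2⟩)
    (hinj : ∀ Fu : Lamination m M du,
      IsStrongUnstableLamination f (maximalInvariantSet f.toHomeomorph U) Eu Fu →
        InjectiveOnLeaves Fu h)
    (Q : Set M) (hQ : IsChainRecurrenceClass f Q)
    (hfib : ∀ x : maximalInvariantSet f.toHomeomorph U,
      fibre h (h x) ⊆ Fcs.localLeaf U x ∧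
        relFrontier Fcs.leafTopology (Fcs.localLeaf U x) (fibre h (h x)) ⊆ Q)
    (hhol : ∀ Fu : Lamination m M du,
      IsStrongUnstableLamination f (maximalInvariantSet f.toHomeomorph U) Eu Fu →
        FibresHolonomyInvariant U Fu Fcs h)
    (hexp : IsExpansive g) :
    ∀ R : Set M, IsChainRecurrenceClass f R → R ⊆ U → R ≠ Q →
      ∃ p ∈ Function.periodicPts g,
        R ⊆ Subtype.val '' (h ⁻¹' (range fun k : ℕ => g^[k] p)) := by
  -- Near `R` the plaques of `Fcs` through `Λ` lie in fibres of `h`, since the frontiers of the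
  -- fibres lie in `Q`. Backward iterates contract the direction transverse to the plaques, so they
  -- contract `h '' R` uniformly at a definite scale, and `h '' R` is finite. Sliding points along
  -- plaques plays the role of the unstable holonomy, so that only the frontier condition on the
  -- fibres and the semiconjugacy are needed.
  intro R hR hRU hRQ
  let Λ := maximalInvariantSet f.toHomeomorph U
  have hRΛ : R ⊆ Λ := IsChainRecurrenceClass.subset_maximalInvariantSet (f := f.toHomeomorph) hR hRU
  have hfc : Continuous f := f.continuous
  have hfΛ : MapsTo f Λ Λ := fun x hx => map_mem_maximalInvariantSet f.toHomeomorph U hx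
  have hfΛ' : MapsTo f.symm Λ Λ := fun x hx => symm_map_mem_maximalInvariantSet f.toHomeomorph U hx
  have hRc : IsCompact R := (hR.isClosed hfc).isCompact
  have : CompactSpace Λ := isCompact_iff_compactSpace.1 hPH.isCompact
  have : CompactSpace R := isCompact_iff_compactSpace.1 hRc
  obtain ⟨n, e, he, hemb, he'⟩ := exists_embedding_euclidean_of_compact (I := 𝓡 m) (M := M)
  obtain ⟨K, δ, hδ, hstep⟩ := hRc.exists_uniform_contraction hemb.isEmbedding (h := h)
    (F := f.symm) fun x hx => Fcs.eventually_exists_contraction f hFcs.1 (fun x => (hfib x).2) hPH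
      hFcs.2.2 hfΛ hfΛ' (he.of_le (by simp)) he' (hRΛ hx) (hU.isOpen.mem_nhds (hRU hx))
      ((hQ.isClosed hfc).isOpen_compl.mem_nhds fun hxQ => hRQ (hR.eq_of_mem hQ hx hxQ))
  let F : Λ → Λ := hfΛ'.restrict f.symm Λ Λ
  have hFval : ∀ k (z : Λ), (F^[k] z : M) = f.symm^[k] z := fun k z =>
    hfΛ'.coe_iterate_restrict z k
  have hFsemi : ∀ y, h (F y) = g.symm (h y) := fun y => by
    rw [Homeomorph.eq_symm_apply, hsemi]
    exact congrArg h (Subtype.ext (f.apply_symm_apply _))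
  have hunif := fun η (hη : 0 < η) => uniform_contraction_of_step (η := η) hFsemi
    (R := {z : Λ | (z : M) ∈ R})
    (fun z hz => IsChainRecurrenceClass.symm_map_mem (f := f.toHomeomorph) hR hz)
    (σ := fun z z' => dist (e z) (e z')) (K := K) (δ := δ)
    (fun z hz z' hzz' => by simpa only [hFval] using hstep z hz z' hzz')
    (fun η hη i => (hemb.isEmbedding.comp IsEmbedding.subtypeVal).exists_dist_lt_of_compact
      ((g.symm.continuous.iterate i).comp hcont) hη)
    (fun _ _ => dist_nonneg) hδ hη
  obtain ⟨δ', hδ', heδ⟩ := Metric.uniformContinuous_iff.1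
    (CompactSpace.uniformContinuous_of_continuous hemb.continuous) δ hδ
  let k : R → Γ := fun x => h ⟨x, hRΛ x.2⟩
  have hk : Continuous k := hcont.comp (continuous_subtype_val.subtype_mk _)
  have hgk : ∀ x : R, g (k x) = k ⟨f x, hR.map_mem hfc x.2⟩ := fun x => hsemi _
  have hback : ∀ n : ℕ, ∀ y : R, ∃ z : R, g.symm^[n] (k z) = k y := by
    -- The witness is the `n`-th forward image of `y`, which stays in `R`.
    intro n
    induction n with
    | zero => exact fun y => ⟨y, rfl⟩
    | succ n ih =>
      intro y
      obtain ⟨z, hz⟩ := ih y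
      refine ⟨⟨f z, hR.map_mem hfc z.2⟩, ?_⟩
      rw [Function.iterate_succ_apply, ← hgk, Homeomorph.symm_apply_apply, hz]
  have hfin : (range k).Finite := finite_range_of_contraction hback hδ' fun η hη => by
    obtain ⟨n₀, hn₀⟩ := hunif η hη
    exact ⟨n₀, fun z z' hzz' => hn₀ n₀ le_rfl ⟨z, hRΛ z.2⟩ z.2 ⟨z', hRΛ z'.2⟩ (heδ hzz')⟩
  obtain ⟨p, hp, hall⟩ := hR.exists_periodic_of_finite hfc g.injective hk hgk hfin
  refine ⟨p, hp, fun x hx => ?_⟩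
  obtain ⟨j, hj⟩ := hall ⟨x, hx⟩
  exact ⟨⟨x, hRΛ hx⟩, ⟨j, hj.symm⟩, rfl⟩
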